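/- Let $k\ge 1$ be a constant. There is a quantum tester for $k$-wise uniformity testing with query complexity $O(\sqrt{n^k}/\varepsilon)$. Precisely: there is a constant $C>0$ depending only on $k$ such that for every $n$, every $\varepsilon>0$ and every finite-dimensional register $A$ with a designated basis state $|0\rangle_A$, there is a quantum query algorithm making at most $C\sqrt{n^k}/\varepsilon$ queries with the following property. Let $p$ be any probability distribution on $\{0,1\}^n$, and let $U_p$ be any purified oracle for $p$, that is, a unitary acting on $A$ and an $n$-qubit register $B$ such that $$U_p|0\rangle_A|0\rangle_B=\sum_{x\in\{0,1\}^n}\sqrt{p_x}\,|\phi_x\rangle_A|x\rangle_B$$ for some orthonormal states $|\phi_x\rangle$. Run with oracle $U_p$, the algorithm answers YES with probability at least $2/3$ if $p$ is $k$-wise uniform, and NO with probability at least $2/3$ if $p$ is $\varepsilon$-far from every $k$-wise uniform distribution, i.e. $d_{\mathrm{TV}}(p,q)=\frac12\sum_x|p_x-q_x|\ge\varepsilon$ for every $k$-wise uniform distribution $q$ on $\{0,1\}^n$. Here $p$ is $k$-wise uniform if $\Pr_{x\sim p}[x_S=v]=2^{-k}$ for every set $S\subseteq\{1,\dots,n\}$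 of $k$ coordinates and every $v\in\{0,1\}^k$. A quantum query algorithm starts in a fixed basis state, applies a fixed sequence of oracle-independent unitaries and queries, with any workspace, and ends with a measurement in the computational basis; a query is one application of $U_p$, $U_p^\dagger$ or the controlled version of either. -/

import Mathlib

open scoped Matrix Kronecker

noncomputable section

/-! ### Distributions on the Boolean cube

Distributions on a finite set `Ω` are the elements of `stdSimplex ℝ Ω`, that is, the functions
`p : Ω → ℝ` with nonnegative values that sum to `1`. -/

/-- The total variation distance, half of the `ℓ¹`-distance. -/
def tvDist {Ω : Type} [Fintype Ω] (p q : Ω → ℝ) : ℝ :=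
  (1 / 2) * ∑ x, |p x - q x|

/-- `p` on `{0,1}ⁿ` is `k`-wise uniform: its marginal on every set of exactly `k` coordinates is
the uniform distribution. -/
def IsKWiseUniform {n : ℕ} (k : ℕ) (p : (Fin n → Bool) → ℝ) : Prop :=
  ∀ S : Finset (Fin n), S.card = k → ∀ v : S → Bool,
    ∑ x : Fin n → Bool with (∀ i : S, x i = v i), p x = 1 / 2 ^ k

/-- `p` is at total variation distance at least `ε` from every `k`-wise uniform distribution. -/
def IsFarFromKWiseUniform {n : ℕ} (k : ℕ) (ε : ℝ) (p : (Fin n → Bool) → ℝ) : Prop :=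
  ∀ q ∈ stdSimplex ℝ (Fin n → Bool), IsKWiseUniform k q → ε ≤ tvDist p q

/-! ### Purified query access -/

/-- The unitary `U` on the registers `A` and `B` (with computational bases `A` and `Ω`) is a
purified oracle for `p`: there are orthonormal states `|φ_i⟩` of register `A` with
`U |a₀⟩|b₀⟩ = ∑ i, √(p i) |φ_i⟩|i⟩`. The basis states `a₀`, `b₀` are the all-zero states. -/
def IsPurifiedOracle {A Ω : Type} [Fintype A] [DecidableEq A] [Fintype Ω] [DecidableEq Ω]
    (a₀ : A) (b₀ : Ω) (p : Ω → ℝ) (U : Matrix.unitaryGroup (A × Ω) ℂ) : Prop :=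
  ∃ φ : Ω → EuclideanSpace ℂ A, Orthonormal ℂ φ ∧
    (U : Matrix (A × Ω) (A × Ω) ℂ) *ᵥ Pi.single (a₀, b₀) 1 =
      fun ai => (Real.sqrt (p ai.2) : ℂ) * φ ai.2 ai.1

/-! ### Quantum query algorithms

The memory of an algorithm consists of a control qubit, a query register with computational
basis `ι`, on which the oracle acts, and a work register with computational basis `W`. -/

/-- One step of a quantum query algorithm: a unitary that does not depend on the oracle and may
act on the whole memory, or one query. A query applies `U` or `U†` (if `inverse`) to the query
register, and may be `controlled` by the control qubit. -/
inductive QueryStep (ι W : Type) [Fintype ι] [DecidableEq ι] [Fintype W] [DecidableEq W] : Type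
  | gate (V : Matrix.unitaryGroup (Bool × (ι × W)) ℂ)
  | query (controlled inverse : Bool)

namespace QueryStep

variable {ι W : Type} [Fintype ι] [DecidableEq ι] [Fintype W] [DecidableEq W]

/-- The number of queries (`0` or `1`) that a step makes. -/
def cost : QueryStep ι W → ℕ
  | gate _ => 0
  | query _ _ => 1

/-- The operator that a step applies to the memory when the oracle is `U`. -/
def toMatrix (U : Matrix.unitaryGroup ι ℂ) :
    QueryStep ι W → Matrix (Bool × (ι × W)) (Bool × (ι × W)) ℂ
  | gate V => V
  | query controlled inverse =>
      let Q : Matrix ι ι ℂ := if inverse then (U : Matrix ι ι ℂ)ᴴ else U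
      if controlled then
        Matrix.single false false (1 : ℂ) ⊗ₖ (1 : Matrix (ι × W) (ι × W) ℂ) +
          Matrix.single true true (1 : ℂ) ⊗ₖ (Q ⊗ₖ (1 : Matrix W W ℂ))
      else
        (1 : Matrix Bool Bool ℂ) ⊗ₖ (Q ⊗ₖ (1 : Matrix W W ℂ))

end QueryStep

/-- A quantum query algorithm with a yes-or-no answer: it starts in a fixed basis state, performs
the steps in the order of the list, measures the memory in the computational basis, and answers
YES if the outcome lies in `accept`. -/
structure QueryAlgorithm (ι : Type) [Fintype ι] [DecidableEq ι] where
  W : Type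
  [fintypeW : Fintype W]
  [decidableEqW : DecidableEq W]
  init : Bool × (ι × W)
  steps : List (QueryStep ι W)
  accept : Finset (Bool × (ι × W))

attribute [instance] QueryAlgorithm.fintypeW QueryAlgorithm.decidableEqW

namespace QueryAlgorithm

variable {ι : Type} [Fintype ι] [DecidableEq ι]

/-- The query complexity: the number of queries to `U`, `U†` and their controlled versions. -/
def queryCount (T : QueryAlgorithm ι) : ℕ :=
  (T.steps.map QueryStep.cost).sum

/-- The state of the memory at the end of the run with oracle `U`. -/
def finalState (T : QueryAlgorithm ι) (U : Matrix.unitaryGroup ι ℂ) : Bool × (ι × T.W) → ℂ :=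
  T.steps.foldl (fun ψ s => s.toMatrix U *ᵥ ψ) (Pi.single T.init 1)

/-- The probability that the algorithm answers YES when it runs with oracle `U`. -/
def yesProb (T : QueryAlgorithm ι) (U : Matrix.unitaryGroup ι ℂ) : ℝ :=
  ∑ x ∈ T.accept, ‖T.finalState U x‖ ^ 2

/-- The probability that the algorithm answers NO when it runs with oracle `U`. -/
def noProb (T : QueryAlgorithm ι) (U : Matrix.unitaryGroup ι ℂ) : ℝ :=
  ∑ x ∈ T.acceptᶜ, ‖T.finalState U x‖ ^ 2

end QueryAlgorithm

/-- `T` solves `k`-wise uniformity testing on `{0,1}ⁿ` with distance parameter `ε`, for oracles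
with purifying register `A` and zero state `a₀`: for every distribution `p` and every purified
oracle of `p`, it decides correctly with probability at least `2/3` which side of the promise
holds. -/
def IsKWiseUniformityTester {A : Type} [Fintype A] [DecidableEq A] (a₀ : A) {n : ℕ} (k : ℕ)
    (ε : ℝ) (T : QueryAlgorithm (A × (Fin n → Bool))) : Prop :=
  ∀ p ∈ stdSimplex ℝ (Fin n → Bool), ∀ U : Matrix.unitaryGroup (A × (Fin n → Bool)) ℂ,
    IsPurifiedOracle a₀ (fun _ => false) p U →
      (IsKWiseUniform k p → 2 / 3 ≤ T.yesProb U) ∧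
      (IsFarFromKWiseUniform k ε p → 2 / 3 ≤ T.noProb U)

end

/-! For `k ≤ n`, a distribution is `k`-wise uniform exactly when its biases at all `S` with `1 ≤ |S|
≤ k` vanish. The proof combines a dimension-free robust form of this fact with amplitude detection.

Robustness (`lt_sqrt_sum_bias_of_isFar`): if `p` is `ε`-far, the `ℓ²`-norm of these biases exceeds
`ε / (12 * 3 ^ k)`. Otherwise a small admixture of a distribution `r` with prescribed biases would
cancel them. Such an `r` exists by convex duality (`exists_bias_eq`): the only obstruction is a
mean-zero polynomial of degree at most `k` whose maximum is small compared with its `L²`-norm, and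
hypercontractivity (`bonami`) excludes it.

Detection (`exists_detector`): start from the oracle's zero state with a work register in uniform
superposition over the `n ^ k` functions `f : Fin k → Fin n`, and apply `X = U† D U`, where `D` is
the sign of the character of the image of `f`. The probability `s` of finding the query register
back in its zero state is the mean over `f` of the squared biases: zero in the uniform case, at
least of order `ε ^ 2 / n ^ k` in the far case. Let `G` be the product of the reflection at the
start vector `σ` and the `X`-conjugate of the reflection at the zero state. If `s = 0`, then `G`
fixes `σ`. If `s > 0`, then `σ = G u - u` with `‖u‖² = 1 / (4 s)`, so the mean of `⟨σ, G ^ j σ⟩`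
over `j < J` is at most `1 / (J √s)` in absolute value. This mean is the acceptance amplitude, and
`J` of order `√(n ^ k) / ε` suffices. -/

/-! ### Fourier analysis on the Boolean cube -/

section BooleanCube

variable {ι : Type}

/-- The character of the Boolean cube indexed by `S`. -/
def walsh (S : Finset ι) (x : ι → Bool) : ℝ := ∏ i ∈ S, if x i then -1 else 1

lemma walsh_empty (x : ι → Bool) : walsh ∅ x = 1 := by simp [walsh]

lemma walsh_singleton (a : ι) (x : ι → Bool) : walsh {a} x = if x a then -1 else 1 := by
  simp [walsh]

lemma walsh_sq (S : Finset ι) (x : ι → Bool) : walsh S x * walsh S x = 1 := by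
  rw [walsh, ← Finset.prod_mul_distrib]
  refine Finset.prod_eq_one fun i _ => ?_
  split_ifs <;> norm_num

variable [DecidableEq ι]

/-- Negate the coordinate `a`. -/
def flipCoord (a : ι) (x : ι → Bool) : ι → Bool := Function.update x a (!x a)

lemma flipCoord_flipCoord (a : ι) (x : ι → Bool) : flipCoord a (flipCoord a x) = x := by
  simp [flipCoord]

lemma walsh_insert {a : ι} {S : Finset ι} (h : a ∉ S) (x : ι → Bool) :
    walsh (insert a S) x = walsh {a} x * walsh S x := by
  rw [walsh, Finset.prod_insert h, walsh_singleton, walsh]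

lemma walsh_flipCoord_of_notMem {a : ι} {S : Finset ι} (h : a ∉ S) (x : ι → Bool) :
    walsh S (flipCoord a x) = walsh S x := by
  refine Finset.prod_congr rfl fun i hi => ?_
  rw [flipCoord, Function.update_of_ne]
  rintro rfl
  exact h hi

lemma walsh_flipCoord_of_mem {a : ι} {S : Finset ι} (h : a ∈ S) (x : ι → Bool) :
    walsh S (flipCoord a x) = - walsh S x := by
  rw [← Finset.insert_erase h, walsh_insert (Finset.notMem_erase a S),
    walsh_insert (Finset.notMem_erase a S),
    walsh_flipCoord_of_notMem (Finset.notMem_erase a S), walsh_singleton, walsh_singleton]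
  cases hx : x a <;> simp [flipCoord, hx]

/-- The sets containing `a` lose one element when `a` is factored out, so their part has degree one
less. This drop drives the induction in `bonami`. -/
lemma sum_walsh_insert {a : ι} {T : Finset ι} (ha : a ∉ T) (k : ℕ) (c : Finset ι → ℝ)
    (x : ι → Bool) :
    ∑ S ∈ (insert a T).powerset with S.card ≤ k + 1, c S * walsh S x =
      ∑ S ∈ T.powerset with S.card ≤ k + 1, c S * walsh S x +
        walsh {a} x * ∑ S ∈ T.powerset with S.card ≤ k, c (insert a S) * walsh S x := by
  simp only [Finset.sum_filter]
  rw [Finset.sum_powerset_insert ha, Finset.mul_sum]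
  congr 1
  refine Finset.sum_congr rfl fun S hS => ?_
  have haS : a ∉ S := fun h => ha (Finset.mem_powerset.1 hS h)
  rw [Finset.card_insert_of_notMem haS, walsh_insert haS]
  simp only [Nat.add_le_add_iff_right]
  split_ifs <;> ring

variable [Fintype ι]

lemma sum_eq_zero_of_flipCoord (a : ι) (f : (ι → Bool) → ℝ)
    (h : ∀ x, f (flipCoord a x) = - f x) : ∑ x, f x = 0 := by
  have e : ∑ x, f (flipCoord a x) = ∑ x, f x :=
    Equiv.sum_comp (Function.Involutive.toPerm _ (flipCoord_flipCoord a)) f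
  simp only [h, Finset.sum_neg_distrib] at e
  linarith

lemma sum_walsh_mul_walsh (S T : Finset ι) :
    ∑ x, walsh S x * walsh T x = if S = T then (2 : ℝ) ^ Fintype.card ι else 0 := by
  split_ifs with h
  · subst h
    simp [walsh_sq]
  · have : ∃ a, (a ∈ S ∧ a ∉ T) ∨ (a ∉ S ∧ a ∈ T) := by
      by_contra! hc
      exact h (Finset.ext fun a => ⟨(hc a).1, fun ha => by
        by_contra hb
        exact (hc a).2 hb ha⟩)
    obtain ⟨a, ha | ha⟩ := this
    · refine sum_eq_zero_of_flipCoord a _ fun x => ?_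
      rw [walsh_flipCoord_of_mem ha.1, walsh_flipCoord_of_notMem ha.2, neg_mul]
    · refine sum_eq_zero_of_flipCoord a _ fun x => ?_
      rw [walsh_flipCoord_of_notMem ha.1, walsh_flipCoord_of_mem ha.2, mul_neg]

lemma sum_walsh_of_ne_empty {S : Finset ι} (h : S ≠ ∅) : ∑ x, walsh S x = 0 := by
  simpa [walsh_empty, h] using sum_walsh_mul_walsh S ∅

/-- Plancherel's identity. -/
lemma sum_sq_sum_walsh (s : Finset (Finset ι)) (c : Finset ι → ℝ) :
    ∑ x, (∑ S ∈ s, c S * walsh S x) ^ 2 = (2 : ℝ) ^ Fintype.card ι * ∑ S ∈ s, c S ^ 2 := by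
  have : ∀ x, (∑ S ∈ s, c S * walsh S x) ^ 2
      = ∑ S ∈ s, ∑ T ∈ s, c S * c T * (walsh S x * walsh T x) := fun x => by
    rw [sq, Finset.sum_mul_sum]
    refine Finset.sum_congr rfl fun S _ => Finset.sum_congr rfl fun T _ => by ring
  simp only [this]
  rw [Finset.sum_comm, Finset.mul_sum]
  refine Finset.sum_congr rfl fun S hS => ?_
  rw [Finset.sum_comm]
  simp only [← Finset.mul_sum, sum_walsh_mul_walsh]
  simp [hS]
  ring

/-- Bonami's lemma: the `(2,4)`-hypercontractive inequality for polynomials of degree at most `k`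
on the Boolean cube. -/
theorem bonami (T : Finset ι) : ∀ (k : ℕ) (c : Finset ι → ℝ),
    (2 : ℝ) ^ Fintype.card ι * ∑ x, (∑ S ∈ T.powerset with S.card ≤ k, c S * walsh S x) ^ 4 ≤
      9 ^ k * (∑ x, (∑ S ∈ T.powerset with S.card ≤ k, c S * walsh S x) ^ 2) ^ 2 := by
  have const (r : ℝ) : (2 : ℝ) ^ Fintype.card ι * ∑ _x : ι → Bool, r ^ 4 ≤
      (∑ _x : ι → Bool, r ^ 2) ^ 2 := by
    simp only [Finset.sum_const, Finset.card_univ, Fintype.card_fun, Fintype.card_bool, nsmul_eq_mul]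
    push_cast
    exact le_of_eq (by ring)
  induction T using Finset.induction_on with
  | empty =>
    intro k c
    simp only [Finset.powerset_empty, Finset.filter_singleton, Finset.card_empty, zero_le, if_true,
      Finset.sum_singleton, walsh_empty, mul_one]
    refine (const (c ∅)).trans (le_mul_of_one_le_left (sq_nonneg _) ?_)
    exact one_le_pow₀ (by norm_num)
  | insert a T ha ih =>
    intro k c
    cases k with
    | zero =>
      have : ({S ∈ (insert a T).powerset | S.card ≤ 0} : Finset (Finset ι)) = {∅} := by
        ext S
        simp only [Finset.mem_filter, Finset.mem_powerset, Finset.mem_singleton, nonpos_iff_eq_zero,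
          Finset.card_eq_zero]
        constructor
        · exact fun h => h.2
        · rintro rfl
          simp
      simp only [this, Finset.sum_singleton, walsh_empty, mul_one, pow_zero, one_mul]
      exact const (c ∅)
    | succ k =>
      simp only [sum_walsh_insert ha]
      have ihg := ih (k + 1) c
      have ihh := ih k (fun S => c (insert a S))
      set g : (ι → Bool) → ℝ := fun x => ∑ S ∈ T.powerset with S.card ≤ k + 1, c S * walsh S x
        with hg
      set h : (ι → Bool) → ℝ :=
        fun x => ∑ S ∈ T.powerset with S.card ≤ k, c (insert a S) * walsh S x with hh
      change (2 : ℝ) ^ Fintype.card ι * ∑ x, g x ^ 4 ≤ 9 ^ (k + 1) * (∑ x, g x ^ 2) ^ 2 at ihg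
      change (2 : ℝ) ^ Fintype.card ι * ∑ x, h x ^ 4 ≤ 9 ^ k * (∑ x, h x ^ 2) ^ 2 at ihh
      change (2 : ℝ) ^ Fintype.card ι * ∑ x, (g x + walsh {a} x * h x) ^ 4 ≤
        9 ^ (k + 1) * (∑ x, (g x + walsh {a} x * h x) ^ 2) ^ 2
      have notMem : ∀ m, ∀ S ∈ ({S ∈ T.powerset | S.card ≤ m} : Finset (Finset ι)), a ∉ S :=
        fun m S hS haS => ha (Finset.mem_powerset.1 (Finset.mem_filter.1 hS).1 haS)
      have hgf : ∀ x, g (flipCoord a x) = g x := fun x =>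
        Finset.sum_congr rfl fun S hS => by rw [walsh_flipCoord_of_notMem (notMem _ S hS)]
      have hhf : ∀ x, h (flipCoord a x) = h x := fun x =>
        Finset.sum_congr rfl fun S hS => by rw [walsh_flipCoord_of_notMem (notMem _ S hS)]
      -- Neither `g` nor `h` depends on coordinate `a`, so terms odd in `walsh {a}` cancel under
      -- flipping it.
      have odd : ∀ i j : ℕ, ∑ x, walsh {a} x * (g x ^ i * h x ^ j) = 0 := fun i j =>
        sum_eq_zero_of_flipCoord a _ fun x => by
          rw [walsh_flipCoord_of_mem (Finset.mem_singleton_self a), hgf, hhf, neg_mul]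
      have hw : ∀ x, walsh {a} x ^ 2 = 1 := fun x => by rw [sq, walsh_sq]
      have e2 : ∑ x, (g x + walsh {a} x * h x) ^ 2 = ∑ x, g x ^ 2 + ∑ x, h x ^ 2 := by
        have : ∀ x, (g x + walsh {a} x * h x) ^ 2 =
            g x ^ 2 + h x ^ 2 + 2 * (walsh {a} x * (g x ^ 1 * h x ^ 1)) := fun x => by
          linear_combination h x ^ 2 * hw x
        simp only [this, Finset.sum_add_distrib, ← Finset.mul_sum, odd]
        ring
      have e4 : ∑ x, (g x + walsh {a} x * h x) ^ 4 =
          ∑ x, g x ^ 4 + 6 * ∑ x, g x ^ 2 * h x ^ 2 + ∑ x, h x ^ 4 := by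
        have : ∀ x, (g x + walsh {a} x * h x) ^ 4 =
            g x ^ 4 + 6 * (g x ^ 2 * h x ^ 2) + h x ^ 4 +
              4 * (walsh {a} x * (g x ^ 3 * h x ^ 1)) +
              4 * (walsh {a} x * (g x ^ 1 * h x ^ 3)) := fun x => by
          linear_combination (6 * g x ^ 2 * h x ^ 2 + h x ^ 4 * (walsh {a} x ^ 2 + 1) +
            4 * walsh {a} x * g x * h x ^ 3) * hw x
        simp only [this, Finset.sum_add_distrib, ← Finset.mul_sum, odd]
        ring
      have cs : (∑ x, g x ^ 2 * h x ^ 2) ^ 2 ≤ (∑ x, g x ^ 4) * ∑ x, h x ^ 4 := by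
        have := Finset.sum_mul_sq_le_sq_mul_sq Finset.univ (fun x => g x ^ 2) (fun x => h x ^ 2)
        simpa only [← pow_mul] using this
      rw [e2, e4]
      have hA : 0 ≤ ∑ x, g x ^ 2 := Finset.sum_nonneg fun x _ => sq_nonneg _
      have hB : 0 ≤ ∑ x, h x ^ 2 := Finset.sum_nonneg fun x _ => sq_nonneg _
      have hA4 : 0 ≤ ∑ x, g x ^ 4 := Finset.sum_nonneg fun x _ => by positivity
      have hB4 : 0 ≤ ∑ x, h x ^ 4 := Finset.sum_nonneg fun x _ => by positivity
      have hN : (0 : ℝ) ≤ 2 ^ Fintype.card ι := by positivity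
      have h9 : (0 : ℝ) ≤ 9 ^ k := by positivity
      generalize (∑ x, g x ^ 2) = A at *
      generalize (∑ x, h x ^ 2) = B at *
      generalize (∑ x, g x ^ 4) = A4 at *
      generalize (∑ x, h x ^ 4) = B4 at *
      generalize (∑ x, g x ^ 2 * h x ^ 2) = D at *
      generalize (2 : ℝ) ^ Fintype.card ι = N at *
      -- Cauchy–Schwarz on the mixed term: `3 * 9 ^ k` is the geometric mean of the constants for
      -- `g` and `h`. Then `6 * 3 * 9 ^ k = 2 * 9 ^ (k + 1)`, exactly the cross term of `9 ^ (k + 1)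
      -- * (A + B) ^ 2`.
      have hD : N * D ≤ 3 * 9 ^ k * (A * B) := by
        refine le_of_sq_le_sq ?_ (by positivity)
        calc (N * D) ^ 2 = N ^ 2 * D ^ 2 := by ring
          _ ≤ N ^ 2 * (A4 * B4) := by gcongr
          _ = (N * A4) * (N * B4) := by ring
          _ ≤ (9 ^ (k + 1) * A ^ 2) * (9 ^ k * B ^ 2) := by gcongr
          _ = (3 * 9 ^ k * (A * B)) ^ 2 := by ring
      have hB2 : 0 ≤ 9 ^ k * B ^ 2 := by positivity
      calc N * (A4 + 6 * D + B4) = N * A4 + 6 * (N * D) + N * B4 := by ring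
        _ ≤ 9 ^ (k + 1) * A ^ 2 + 6 * (3 * 9 ^ k * (A * B)) + 9 ^ k * B ^ 2 := by gcongr
        _ ≤ 9 ^ (k + 1) * (A + B) ^ 2 := by
          rw [pow_succ]
          linarith

end BooleanCube

/-! ### Closeness to `k`-wise uniformity -/

section KWise

/-- The Fourier coefficient (bias) of `p` at `S`. -/
def bias {ι : Type} [Fintype ι] [DecidableEq ι] (p : (ι → Bool) → ℝ) (S : Finset ι) : ℝ :=
  ∑ x, p x * walsh S x

/-- The nonempty sets of at most `k` coordinates. -/
def smallSets (ι : Type) [Fintype ι] [DecidableEq ι] (k : ℕ) : Finset (Finset ι) :=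
  {S | S ≠ ∅ ∧ S.card ≤ k}

variable {ι : Type} [Fintype ι] [DecidableEq ι]

lemma mem_smallSets {k : ℕ} {S : Finset ι} : S ∈ smallSets ι k ↔ S ≠ ∅ ∧ S.card ≤ k := by
  simp [smallSets]

/-- Omitting `∅` amounts to a zero coefficient there, which makes `bonami` applicable. -/
lemma sum_smallSets (k : ℕ) (c : Finset ι → ℝ) :
    ∑ S ∈ smallSets ι k, c S =
      ∑ S ∈ (Finset.univ : Finset ι).powerset with S.card ≤ k, if S = ∅ then 0 else c S := by
  rw [smallSets, Finset.sum_filter, Finset.sum_filter]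
  simp only [Finset.powerset_univ]
  refine Finset.sum_congr rfl fun S _ => ?_
  by_cases h : S = ∅ <;> simp [h]

/-- The `(2,4)`-hypercontractive inequality for the part of degree `1, …, k`. -/
lemma bonami_smallSets (k : ℕ) (c : Finset ι → ℝ) :
    ∑ x, (∑ S ∈ smallSets ι k, c S * walsh S x) ^ 4 ≤
      2 ^ Fintype.card ι * 9 ^ k * (∑ S ∈ smallSets ι k, c S ^ 2) ^ 2 := by
  have key := bonami Finset.univ k (fun S => if S = ∅ then 0 else c S)
  have e : ∀ x : ι → Bool, ∑ S ∈ (Finset.univ : Finset ι).powerset with S.card ≤ k,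
      (if S = ∅ then 0 else c S) * walsh S x = ∑ S ∈ smallSets ι k, c S * walsh S x := fun x => by
    rw [sum_smallSets]
    simp only [ite_mul, zero_mul]
  simp only [e, sum_sq_sum_walsh] at key
  have hN : (0 : ℝ) < 2 ^ Fintype.card ι := by positivity
  refine le_of_mul_le_mul_left (key.trans (le_of_eq ?_)) hN
  ring

lemma sum_sum_smallSets_eq_zero (k : ℕ) (c : Finset ι → ℝ) :
    ∑ x : ι → Bool, ∑ S ∈ smallSets ι k, c S * walsh S x = 0 := by
  rw [Finset.sum_comm]
  refine Finset.sum_eq_zero fun S hS => ?_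
  rw [← Finset.mul_sum, sum_walsh_of_ne_empty (mem_smallSets.1 hS).1, mul_zero]

/-- With `s = t / m` this is `s * (1 - s ^ 2) ≤ 1`. Summed over the cube, it bounds the `L¹`-norm
below by the second and fourth moments. -/
lemma sq_div_sub_pow_four_div_le {t m : ℝ} (ht : 0 ≤ t) (hm : 0 < m) :
    t ^ 2 / m - t ^ 4 / m ^ 3 ≤ t := by
  have e : t ^ 2 / m - t ^ 4 / m ^ 3 = t * (t / m * (1 - (t / m) ^ 2)) := by
    field_simp
  rw [e]
  refine mul_le_of_le_one_right ht ?_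
  have hs : 0 ≤ t / m := by positivity
  nlinarith [sq_nonneg (t / m - 1), mul_nonneg hs (sq_nonneg (t / m - 1))]

/-- A polynomial of degree at most `k` on the Boolean cube whose mean is zero takes a value that
is at least a fixed fraction of its `L²`-norm. -/
theorem sqrt_sum_sq_le_of_forall_le (k : ℕ) (c : Finset ι → ℝ) (u : ℝ)
    (hu : ∀ x : ι → Bool, ∑ S ∈ smallSets ι k, c S * walsh S x ≤ u) :
    Real.sqrt (∑ S ∈ smallSets ι k, c S ^ 2) ≤ 6 * 3 ^ k * u := by
  set g : (ι → Bool) → ℝ := fun x => ∑ S ∈ smallSets ι k, c S * walsh S x with hg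
  set N := Real.sqrt (∑ S ∈ smallSets ι k, c S ^ 2) with hNdef
  have hNsq : ∑ S ∈ smallSets ι k, c S ^ 2 = N ^ 2 :=
    (Real.sq_sqrt (Finset.sum_nonneg fun _ _ => sq_nonneg _)).symm
  have hN0 : 0 ≤ N := Real.sqrt_nonneg _
  set M : ℝ := 2 ^ Fintype.card ι with hMdef
  have hM : 0 < M := by positivity
  have hMsum : ∀ r : ℝ, ∑ _x : ι → Bool, r = M * r := fun r => by simp [hMdef]
  have g1 : ∑ x, g x = 0 := sum_sum_smallSets_eq_zero k c
  have g2 : ∑ x, g x ^ 2 = M * N ^ 2 := by rw [← hNsq]; exact sum_sq_sum_walsh _ _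
  have g4 : ∑ x, g x ^ 4 ≤ M * 9 ^ k * (N ^ 2) ^ 2 := by
    rw [← hNsq]; exact bonami_smallSets k c
  have hu0 : 0 ≤ u := by
    have : ∑ x, g x ≤ ∑ _x : ι → Bool, u := Finset.sum_le_sum fun x _ => hu x
    rw [g1, hMsum] at this
    exact nonneg_of_mul_nonneg_right this hM
  rcases hN0.eq_or_lt with h0 | hpos
  · rw [← h0]
    positivity
  -- Zero mean turns the one-sided bound `g ≤ u` into an `L¹`-bound.
  have habs : ∑ x, |g x| ≤ 2 * (M * u) := by
    have : ∀ x, |g x| ≤ 2 * u - g x := fun x => by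
      have := hu x
      rw [abs_le]
      constructor <;> linarith
    calc ∑ x, |g x| ≤ ∑ x, (2 * u - g x) := Finset.sum_le_sum fun x _ => this x
      _ = 2 * (M * u) := by rw [Finset.sum_sub_distrib, hMsum, g1]; ring
  -- With this `m` the fourth-moment term is at most a quarter of the second-moment term, so the
  -- mean of `|g|` is at least `3 * N / (8 * 3 ^ k)`. The resulting constant `16 / 3` is rounded up
  -- to `6`.
  set m : ℝ := 2 * 3 ^ k * N with hm
  have hmpos : 0 < m := by positivity
  have hlow : (∑ x, g x ^ 2) / m - (∑ x, g x ^ 4) / m ^ 3 ≤ ∑ x, |g x| := by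
    rw [Finset.sum_div, Finset.sum_div, ← Finset.sum_sub_distrib]
    refine Finset.sum_le_sum fun x _ => ?_
    have := sq_div_sub_pow_four_div_le (abs_nonneg (g x)) hmpos
    rwa [sq_abs, Even.pow_abs (by decide)] at this
  have h4 : (∑ x, g x ^ 4) / m ^ 3 ≤ M * N / (8 * 3 ^ k) := by
    have h39 : (9 : ℝ) ^ k = 3 ^ k * 3 ^ k := by rw [← mul_pow]; norm_num
    calc (∑ x, g x ^ 4) / m ^ 3 ≤ (M * 9 ^ k * (N ^ 2) ^ 2) / m ^ 3 := by gcongr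
      _ = M * N / (8 * 3 ^ k) := by
        rw [hm, h39]
        field_simp
        norm_num
  have h2 : (∑ x, g x ^ 2) / m = M * N / (2 * 3 ^ k) := by
    rw [g2, hm]
    field_simp
  have hfin : M * N / (2 * 3 ^ k) - M * N / (8 * 3 ^ k) ≤ 2 * (M * u) := by linarith
  have h3 : (0 : ℝ) < 3 ^ k := by positivity
  have e : M * N / (2 * 3 ^ k) - M * N / (8 * 3 ^ k) = M * (3 / 8 * N / 3 ^ k) := by
    field_simp
    norm_num
  rw [e, show 2 * (M * u) = M * (2 * u) by ring] at hfin
  have := le_of_mul_le_mul_left hfin hM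
  rw [div_le_iff₀ h3] at this
  have : 0 ≤ u * 3 ^ k := by positivity
  linarith

/-- Small prescribed Fourier coefficients of degrees `1, …, k` are attained by a distribution. -/
theorem exists_bias_eq (k : ℕ) (a : Finset ι → ℝ)
    (ha : Real.sqrt (∑ S ∈ smallSets ι k, a S ^ 2) ≤ 1 / (6 * 3 ^ k)) :
    ∃ r ∈ stdSimplex ℝ (ι → Bool), ∀ S ∈ smallSets ι k, bias r S = a S := by
  let Φ : ((ι → Bool) → ℝ) →ₗ[ℝ] (smallSets ι k → ℝ) :=
    LinearMap.pi fun S => ∑ x, walsh S.1 x • LinearMap.proj x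
  have hΦ : ∀ r S, Φ r S = bias r S.1 := fun r S => by
    simp [Φ, bias, mul_comm]
  by_contra! hcon
  have hnot : (fun S : smallSets ι k => a S.1) ∉ Φ '' stdSimplex ℝ (ι → Bool) := by
    rintro ⟨r, hr, he⟩
    obtain ⟨S, hS, hne⟩ := hcon r hr
    exact hne (by rw [← hΦ r ⟨S, hS⟩, he])
  have hconv : Convex ℝ (Φ '' stdSimplex ℝ (ι → Bool)) :=
    (convex_stdSimplex ℝ _).linear_image Φ
  have hcomp : IsCompact (Φ '' stdSimplex ℝ (ι → Bool)) :=
    (isCompact_stdSimplex ℝ _).image (LinearMap.continuous_of_finiteDimensional Φ)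
  -- A separating functional is a polynomial with coefficients `c`. Point masses show that it is at
  -- most `u` everywhere, while its pairing with `a` exceeds `u`. The norm bound and Cauchy–Schwarz
  -- contradict this.
  obtain ⟨f, u, hlt, hgt⟩ := geometric_hahn_banach_closed_point hconv hcomp.isClosed hnot
  let c : Finset ι → ℝ := fun S => if h : S ∈ smallSets ι k then f (Pi.single ⟨S, h⟩ 1) else 0
  have hf : ∀ v : Finset ι → ℝ, f (fun S : smallSets ι k => v S.1) =
      ∑ S ∈ smallSets ι k, c S * v S := fun v => by
    have : (fun S : smallSets ι k => v S.1) =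
        ∑ S : smallSets ι k, v S.1 • (Pi.single S 1 : smallSets ι k → ℝ) := by
      ext T
      simp [Finset.sum_apply, Pi.single_apply]
    rw [this, map_sum, ← Finset.sum_coe_sort (smallSets ι k)]
    refine Finset.sum_congr rfl fun S _ => ?_
    simp [c, mul_comm]
  have hpoint : ∀ x : ι → Bool, ∑ S ∈ smallSets ι k, c S * walsh S x ≤ u := fun x => by
    have h1 := hlt _ ⟨Pi.single x 1, single_mem_stdSimplex ℝ x, rfl⟩
    have h2 : Φ (Pi.single x 1) = fun S : smallSets ι k => walsh S.1 x := by
      ext S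
      rw [hΦ, bias]
      simp [Pi.single_apply]
    rw [h2, hf (fun S => walsh S x)] at h1
    exact h1.le
  have hnorm := sqrt_sum_sq_le_of_forall_le k c u hpoint
  rw [hf a] at hgt
  have cs := Real.sum_mul_le_sqrt_mul_sqrt (smallSets ι k) c a
  have h6 : (0 : ℝ) < 6 * 3 ^ k := by positivity
  have : Real.sqrt (∑ S ∈ smallSets ι k, c S ^ 2) * Real.sqrt (∑ S ∈ smallSets ι k, a S ^ 2) ≤ u :=
    calc _ ≤ Real.sqrt (∑ S ∈ smallSets ι k, c S ^ 2) * (1 / (6 * 3 ^ k)) := by gcongr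
      _ ≤ u := by
        rw [mul_one_div, div_le_iff₀ h6]
        linarith
  linarith

lemma bias_linear (p r : (ι → Bool) → ℝ) (s t : ℝ) (S : Finset ι) :
    bias (s • p + t • r) S = s * bias p S + t * bias r S := by
  simp only [bias, Pi.add_apply, Pi.smul_apply, smul_eq_mul, add_mul, Finset.sum_add_distrib,
    Finset.mul_sum, mul_assoc]

lemma tvDist_le_one {Ω : Type} [Fintype Ω] {p q : Ω → ℝ} (hp : p ∈ stdSimplex ℝ Ω)
    (hq : q ∈ stdSimplex ℝ Ω) : tvDist p q ≤ 1 := by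
  have : ∑ x, |p x - q x| ≤ ∑ x, (p x + q x) := Finset.sum_le_sum fun x _ => by
    have := hp.1 x
    have := hq.1 x
    rw [abs_le]
    constructor <;> linarith
  rw [Finset.sum_add_distrib, hp.2, hq.2] at this
  rw [tvDist]
  linarith

lemma tvDist_mix {Ω : Type} [Fintype Ω] (p r : Ω → ℝ) {η : ℝ} (hη : 0 ≤ η) :
    tvDist p ((1 - η) • p + η • r) = η * tvDist p r := by
  simp only [tvDist, Pi.add_apply, Pi.smul_apply, smul_eq_mul]
  have : ∀ x, |p x - ((1 - η) * p x + η * r x)| = η * |p x - r x| := fun x => by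
    rw [show p x - ((1 - η) * p x + η * r x) = η * (p x - r x) by ring, abs_mul, abs_of_nonneg hη]
  simp only [this, ← Finset.mul_sum]
  ring

/-- A distribution with small Fourier coefficients of degrees `1, …, k` is close to one for which
they vanish. -/
theorem exists_bias_eq_zero_tvDist_le (k : ℕ) {p : (ι → Bool) → ℝ}
    (hp : p ∈ stdSimplex ℝ (ι → Bool)) {η : ℝ} (hη : 0 < η) (hη1 : η ≤ 1)
    (h : Real.sqrt (∑ S ∈ smallSets ι k, bias p S ^ 2) ≤ η / (6 * 3 ^ k)) :
    ∃ q ∈ stdSimplex ℝ (ι → Bool), (∀ S ∈ smallSets ι k, bias q S = 0) ∧ tvDist p q ≤ η := by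
  -- These biases are chosen so that those of `(1 - η) • p + η • r` cancel.
  obtain ⟨r, hr, hbr⟩ := exists_bias_eq k (fun S => -((1 - η) / η) * bias p S) (by
    simp only [mul_pow, ← Finset.mul_sum]
    rw [Real.sqrt_mul (sq_nonneg _), Real.sqrt_sq_eq_abs, abs_neg,
      abs_of_nonneg (div_nonneg (by linarith) hη.le)]
    calc (1 - η) / η * Real.sqrt (∑ S ∈ smallSets ι k, bias p S ^ 2)
        ≤ 1 / η * (η / (6 * 3 ^ k)) := by
          gcongr
          linarith
      _ = 1 / (6 * 3 ^ k) := by field_simp)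
  refine ⟨(1 - η) • p + η • r, convex_stdSimplex ℝ _ hp hr (by linarith) hη.le (by ring), ?_, ?_⟩
  · intro S hS
    rw [bias_linear, hbr S hS]
    field_simp
    ring
  · rw [tvDist_mix p r hη.le]
    exact mul_le_of_le_one_right hη.le (tvDist_le_one hp hr)

/-- The indicator of a subcube as a polynomial. -/
lemma ite_forall_eq_sum_walsh (T : Finset ι) (v x : ι → Bool) :
    (if ∀ i ∈ T, x i = v i then (1 : ℝ) else 0) =
      1 / 2 ^ T.card * ∑ S ∈ T.powerset, walsh S v * walsh S x := by
  have h : ∀ S ∈ T.powerset, walsh S v * walsh S x =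
      ∏ i ∈ S, ((if v i then (-1 : ℝ) else 1) * (if x i then -1 else 1)) := fun S _ => by
    rw [walsh, walsh, Finset.prod_mul_distrib]
  rw [Finset.sum_congr rfl h, ← Finset.prod_one_add, one_div, ← inv_pow, ← Finset.prod_const,
    ← Finset.prod_mul_distrib]
  split_ifs with hx
  · refine (Finset.prod_eq_one fun i hi => ?_).symm
    rw [hx i hi]
    split_ifs <;> norm_num
  · push Not at hx
    obtain ⟨i, hi, hne⟩ := hx
    refine (Finset.prod_eq_zero hi ?_).symm
    cases hxi : x i <;> cases hvi : v i <;> simp_all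

lemma sum_walsh_powerset_of_ne_empty {ι : Type} [DecidableEq ι] {S T : Finset ι}
    (hST : S ⊆ T) (hS : S ≠ ∅) :
    ∑ v : T → Bool, walsh (S.subtype (· ∈ T)) v = 0 := by
  refine sum_walsh_of_ne_empty fun h => ?_
  obtain ⟨a, ha⟩ := Finset.nonempty_iff_ne_empty.2 hS
  have : (⟨a, hST ha⟩ : T) ∈ S.subtype (· ∈ T) := by simpa using ha
  simp [h] at this

lemma walsh_subtype {ι : Type} [DecidableEq ι] {S T : Finset ι} (hST : S ⊆ T) (x : ι → Bool) :
    walsh (S.subtype (· ∈ T)) (fun i : T => x i) = walsh S x := by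
  have h := Finset.prod_map (S.subtype (· ∈ T)) (Function.Embedding.subtype _)
    (fun i => if x i then (-1 : ℝ) else 1)
  rw [Finset.subtype_map_of_mem fun i hi => hST hi] at h
  exact h.symm

theorem bias_eq_zero_of_isKWiseUniform {n k : ℕ} (hkn : k ≤ n) {p : (Fin n → Bool) → ℝ}
    (hp : IsKWiseUniform k p) {S : Finset (Fin n)} (hS : S ∈ smallSets (Fin n) k) :
    bias p S = 0 := by
  obtain ⟨hne, hcard⟩ := mem_smallSets.1 hS
  -- Only marginals on exactly `k` coordinates are known to be uniform, so a smaller `S` is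
  -- enlarged; this needs `k ≤ n`.
  obtain ⟨T, hST, hT⟩ := Finset.exists_superset_card_eq hcard (by simpa using hkn)
  have hsum : bias p S = ∑ v : T → Bool, ∑ x : Fin n → Bool with (∀ i : T, x i = v i),
      p x * walsh S x := by
    rw [bias, ← Finset.sum_fiberwise Finset.univ (fun (x : Fin n → Bool) (i : T) => x i)]
    simp only [funext_iff]
  rw [hsum]
  have : ∀ v : T → Bool, ∑ x : Fin n → Bool with (∀ i : T, x i = v i), p x * walsh S x =
      1 / 2 ^ k * walsh (S.subtype (· ∈ T)) v := fun v => by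
    rw [← hp T hT v, Finset.sum_mul]
    refine Finset.sum_congr rfl fun x hx => ?_
    rw [← walsh_subtype hST x, show (fun i : T => x i) = v from
      funext (Finset.mem_filter.1 hx).2]
  simp only [this, ← Finset.mul_sum, sum_walsh_powerset_of_ne_empty hST hne, mul_zero]

theorem isKWiseUniform_of_bias_eq_zero {n k : ℕ} {q : (Fin n → Bool) → ℝ}
    (hq : q ∈ stdSimplex ℝ (Fin n → Bool)) (h : ∀ S ∈ smallSets (Fin n) k, bias q S = 0) :
    IsKWiseUniform k q := by
  intro T hT v
  let w : Fin n → Bool := fun i => if hi : i ∈ T then v ⟨i, hi⟩ else false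
  have e : ∀ x : Fin n → Bool, (∀ i : T, x i = v i) ↔ ∀ i ∈ T, x i = w i := fun x => by
    constructor
    · intro hx i hi
      simp [w, hi, hx ⟨i, hi⟩]
    · intro hx i
      simp [hx i i.2, w]
  have hempty : bias q ∅ = 1 := by simp [bias, walsh_empty, hq.2]
  calc ∑ x : Fin n → Bool with (∀ i : T, x i = v i), q x
      = ∑ x, q x * (1 / 2 ^ T.card * ∑ S ∈ T.powerset, walsh S w * walsh S x) := by
        rw [Finset.sum_filter]
        refine Finset.sum_congr rfl fun x _ => ?_
        rw [← ite_forall_eq_sum_walsh]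
        simp only [e]
        split_ifs <;> simp
    _ = 1 / 2 ^ T.card * ∑ S ∈ T.powerset, walsh S w * bias q S := by
        simp only [bias, Finset.mul_sum]
        rw [Finset.sum_comm]
        exact Finset.sum_congr rfl fun S _ => Finset.sum_congr rfl fun x _ => by ring
    _ = 1 / 2 ^ k := by
        rw [Finset.sum_eq_single ∅, hempty, walsh_empty, hT]
        · ring
        · intro S hS hne
          have hcard : S.card ≤ k := hT ▸ Finset.card_le_card (Finset.mem_powerset.1 hS)
          rw [h S (mem_smallSets.2 ⟨hne, hcard⟩), mul_zero]
        · simp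

/-- A distribution that is far from `k`-wise uniform has large Fourier weight on the degrees
`1, …, k`, independently of the dimension. -/
theorem lt_sqrt_sum_bias_of_isFar {n k : ℕ} {ε : ℝ} (hε : 0 < ε) (hε1 : ε ≤ 1)
    {p : (Fin n → Bool) → ℝ} (hp : p ∈ stdSimplex ℝ (Fin n → Bool))
    (hfar : IsFarFromKWiseUniform k ε p) :
    ε / 2 / (6 * 3 ^ k) < Real.sqrt (∑ S ∈ smallSets (Fin n) k, bias p S ^ 2) := by
  by_contra! hle
  -- Being far allows distance exactly `ε`; using `ε / 2` makes the contradiction strict.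
  obtain ⟨q, hq, hb, hd⟩ :=
    exists_bias_eq_zero_tvDist_le k hp (half_pos hε) (by linarith) hle
  have := hfar q hq (isKWiseUniform_of_bias_eq_zero hq hb)
  linarith

end KWise

/-! ### Unitary matrices and norms of vectors -/

section NormSq

variable {κ : Type} [Fintype κ]

/-- The squared Euclidean norm of a vector. -/
noncomputable def normSqVec (v : κ → ℂ) : ℝ := ∑ i, ‖v i‖ ^ 2

lemma star_dotProduct_self (v : κ → ℂ) : star v ⬝ᵥ v = (normSqVec v : ℂ) := by
  simp only [dotProduct, normSqVec, Pi.star_apply, Complex.ofReal_sum, Complex.ofReal_pow]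
  refine Finset.sum_congr rfl fun i _ => ?_
  rw [← Complex.conj_mul']
  rfl

lemma normSqVec_smul (c : ℂ) (v : κ → ℂ) : normSqVec (c • v) = ‖c‖ ^ 2 * normSqVec v := by
  simp only [normSqVec, Pi.smul_apply, smul_eq_mul, norm_mul, mul_pow, Finset.mul_sum]

/-- The Cauchy–Schwarz inequality. -/
lemma norm_star_dotProduct_sq_le (v w : κ → ℂ) :
    ‖star v ⬝ᵥ w‖ ^ 2 ≤ normSqVec v * normSqVec w := by
  have h : ‖star v ⬝ᵥ w‖ ≤ ∑ i, ‖v i‖ * ‖w i‖ := by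
    refine (norm_sum_le _ _).trans (le_of_eq ?_)
    simp
  calc ‖star v ⬝ᵥ w‖ ^ 2 ≤ (∑ i, ‖v i‖ * ‖w i‖) ^ 2 := by gcongr
    _ ≤ _ := Finset.sum_mul_sq_le_sq_mul_sq _ _ _

variable [DecidableEq κ]

lemma normSqVec_unitary_mulVec (V : Matrix.unitaryGroup κ ℂ) (v : κ → ℂ) :
    normSqVec ((V : Matrix κ κ ℂ) *ᵥ v) = normSqVec v := by
  have h : star ((V : Matrix κ κ ℂ) *ᵥ v) ⬝ᵥ ((V : Matrix κ κ ℂ) *ᵥ v) = star v ⬝ᵥ v := by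
    rw [Matrix.star_mulVec, ← Matrix.dotProduct_mulVec, Matrix.mulVec_mulVec,
      ← Matrix.star_eq_conjTranspose, Unitary.coe_star_mul_self, Matrix.one_mulVec]
  rw [star_dotProduct_self, star_dotProduct_self] at h
  exact_mod_cast h

/-- Every unit vector is the image of a given basis vector under a unitary. -/
lemma exists_unitary_mulVec_single (i : κ) (v : κ → ℂ) (hv : normSqVec v = 1) :
    ∃ V : Matrix.unitaryGroup κ ℂ, (V : Matrix κ κ ℂ) *ᵥ Pi.single i 1 = v := by
  have hnorm : ‖(WithLp.toLp 2 v : EuclideanSpace ℂ κ)‖ = 1 := by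
    rw [EuclideanSpace.norm_eq]
    change Real.sqrt (normSqVec v) = 1
    rw [hv, Real.sqrt_one]
  obtain ⟨b, hb⟩ := Orthonormal.exists_orthonormalBasis_extension_of_card_eq (𝕜 := ℂ)
    (E := EuclideanSpace ℂ κ) (ι := κ) (by simp) (v := fun _ => WithLp.toLp 2 v) (s := {i}) (by
      constructor
      · rintro ⟨j, hj⟩
        simpa using hnorm
      · rintro ⟨j, hj⟩ ⟨j', hj'⟩ hne
        simp only [Set.mem_singleton_iff] at hj hj'
        subst hj hj'
        exact absurd rfl hne)
  refine ⟨⟨_, (EuclideanSpace.basisFun κ ℂ).toMatrix_orthonormalBasis_mem_unitary b⟩, ?_⟩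
  ext m
  rw [Matrix.mulVec_single_one]
  simp [Module.Basis.toMatrix_apply, hb i rfl]

/-- The reflection `1 - 2 Q` at the kernel of an orthogonal projection `Q`. -/
lemma one_sub_two_smul_mem_unitaryGroup {Q : Matrix κ κ ℂ} (hQ : Qᴴ = Q) (hQQ : Q * Q = Q) :
    1 - (2 : ℂ) • Q ∈ Matrix.unitaryGroup κ ℂ := by
  rw [Matrix.mem_unitaryGroup_iff, Matrix.star_eq_conjTranspose, Matrix.conjTranspose_sub,
    Matrix.conjTranspose_one, Matrix.conjTranspose_smul, hQ]
  have : star (2 : ℂ) = 2 := by simp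
  rw [this, sub_mul, one_mul, Matrix.smul_mul, mul_sub, mul_one, Matrix.mul_smul, hQQ]
  module

end NormSq

/-! ### Products of two reflections -/

section Rotation

variable {κ : Type}

/-- The rank-one projection onto the line of a unit vector. -/
noncomputable def rankOne (σ : κ → ℂ) : Matrix κ κ ℂ := Matrix.vecMulVec σ (star σ)

lemma conjTranspose_rankOne (σ : κ → ℂ) : (rankOne σ)ᴴ = rankOne σ := by
  rw [rankOne, Matrix.conjTranspose_vecMulVec, star_star]

variable [Fintype κ]

lemma rankOne_mulVec (σ v : κ → ℂ) : rankOne σ *ᵥ v = (star σ ⬝ᵥ v) • σ := by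
  ext i
  simp [rankOne, Matrix.vecMulVec_apply, Matrix.mulVec, dotProduct, Finset.mul_sum, mul_comm,
    mul_left_comm]

lemma rankOne_mul_self {σ : κ → ℂ} (hσ : normSqVec σ = 1) :
    rankOne σ * rankOne σ = rankOne σ := by
  rw [rankOne, Matrix.vecMulVec_mul_vecMulVec, star_dotProduct_self, hσ]
  simp

variable [DecidableEq κ]

/-- The reflection at the hyperplane orthogonal to a unit vector. -/
noncomputable def vecReflection (σ : κ → ℂ) (hσ : normSqVec σ = 1) : Matrix.unitaryGroup κ ℂ :=
  ⟨1 - (2 : ℂ) • rankOne σ,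
    one_sub_two_smul_mem_unitaryGroup (conjTranspose_rankOne σ) (rankOne_mul_self hσ)⟩

lemma vecReflection_mulVec (σ : κ → ℂ) (hσ : normSqVec σ = 1) (v : κ → ℂ) :
    (vecReflection σ hσ : Matrix κ κ ℂ) *ᵥ v = v - (2 * (star σ ⬝ᵥ v)) • σ := by
  simp only [vecReflection, Matrix.sub_mulVec, Matrix.one_mulVec, Matrix.smul_mulVec,
    rankOne_mulVec, smul_smul]

/-- The diagonal unitary with the signs `±1`. -/
noncomputable def signGate (d : κ → ℝ) (hd : ∀ i, d i * d i = 1) : Matrix.unitaryGroup κ ℂ :=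
  ⟨Matrix.diagonal fun i => (d i : ℂ), by
    rw [Matrix.mem_unitaryGroup_iff, Matrix.star_eq_conjTranspose, Matrix.diagonal_conjTranspose,
      Matrix.diagonal_mul_diagonal, ← Matrix.diagonal_one]
    congr 1
    ext i
    simp only [Pi.star_apply, RCLike.star_def, Complex.conj_ofReal]
    exact_mod_cast hd i⟩

lemma signGate_mulVec (d : κ → ℝ) (hd : ∀ i, d i * d i = 1) (v : κ → ℂ) (i : κ) :
    ((signGate d hd : Matrix κ κ ℂ) *ᵥ v) i = d i * v i := by
  rw [signGate, Matrix.mulVec_diagonal]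

/-- The orbit sum of a coboundary telescopes, so its size does not grow with `J` when `G` is
unitary. -/
lemma sum_pow_mulVec_sub (G : Matrix κ κ ℂ) (u : κ → ℂ) (J : ℕ) :
    ∑ j ∈ Finset.range J, G ^ j *ᵥ (G *ᵥ u - u) = G ^ J *ᵥ u - u := by
  have : ∀ j, G ^ j *ᵥ (G *ᵥ u - u) = G ^ (j + 1) *ᵥ u - G ^ j *ᵥ u := fun j => by
    rw [Matrix.mulVec_sub, Matrix.mulVec_mulVec, pow_succ]
  simp only [this]
  rw [Finset.sum_range_sub (fun j => G ^ j *ᵥ u), pow_zero, Matrix.one_mulVec]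

/-- If `σ = G u - u` with `G` unitary, then the ergodic sums of `σ` are bounded. -/
lemma norm_sum_star_dotProduct_pow_mulVec_sq_le (G : Matrix.unitaryGroup κ ℂ) {σ u : κ → ℂ}
    (hσ : normSqVec σ = 1) (hu : (G : Matrix κ κ ℂ) *ᵥ u - u = σ) (J : ℕ) :
    ‖∑ j ∈ Finset.range J, star σ ⬝ᵥ ((G : Matrix κ κ ℂ) ^ j *ᵥ σ)‖ ^ 2 ≤ 4 * normSqVec u := by
  have hsum : ∑ j ∈ Finset.range J, star σ ⬝ᵥ ((G : Matrix κ κ ℂ) ^ j *ᵥ σ) =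
      star σ ⬝ᵥ ((G : Matrix κ κ ℂ) ^ J *ᵥ u) - star σ ⬝ᵥ u := by
    rw [← dotProduct_sum, ← dotProduct_sub, ← sum_pow_mulVec_sub, hu]
  have h1 := norm_star_dotProduct_sq_le σ ((G : Matrix κ κ ℂ) ^ J *ᵥ u)
  have h2 := norm_star_dotProduct_sq_le σ u
  rw [show (G : Matrix κ κ ℂ) ^ J = ((G ^ J : Matrix.unitaryGroup κ ℂ) : Matrix κ κ ℂ) from rfl,
    normSqVec_unitary_mulVec] at h1
  rw [hsum]
  change ‖star σ ⬝ᵥ ((G : Matrix κ κ ℂ) ^ J *ᵥ u)‖ ^ 2 ≤ _ at h1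
  have h3 := norm_sub_le (star σ ⬝ᵥ ((G : Matrix κ κ ℂ) ^ J *ᵥ u)) (star σ ⬝ᵥ u)
  rw [hσ, one_mul] at h1 h2
  have h4 := pow_le_pow_left₀ (norm_nonneg _) h3 2
  nlinarith [sq_nonneg (‖star σ ⬝ᵥ ((G : Matrix κ κ ℂ) ^ J *ᵥ u)‖ - ‖star σ ⬝ᵥ u‖)]

/-- The product of the reflection at `σ^⊥` and the conjugate by `X` of the reflection with the
signs `d`. -/
noncomputable def grover (σ : κ → ℂ) (hσ : normSqVec σ = 1) (d : κ → ℝ) (hd : ∀ i, d i * d i = 1)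
    (X : Matrix.unitaryGroup κ ℂ) : Matrix.unitaryGroup κ ℂ :=
  vecReflection σ hσ * (X * signGate d hd * X)

variable {σ : κ → ℂ} (hσ : normSqVec σ = 1) {d : κ → ℝ} (hd : ∀ i, d i * d i = 1)
  {X : Matrix.unitaryGroup κ ℂ}

lemma grover_mulVec (v : κ → ℂ) : (grover σ hσ d hd X : Matrix κ κ ℂ) *ᵥ v =
    (vecReflection σ hσ : Matrix κ κ ℂ) *ᵥ ((X : Matrix κ κ ℂ) *ᵥ
      ((signGate d hd : Matrix κ κ ℂ) *ᵥ ((X : Matrix κ κ ℂ) *ᵥ v))) := by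
  simp only [grover, Matrix.mulVec_mulVec, Submonoid.coe_mul, Matrix.mul_assoc]

/-- On `X σ` the sign gate acts as `-1`, so `X D X` sends `σ` to `-σ`, and the reflection restores
the sign. -/
lemma grover_mulVec_self (hXX : X * X = 1)
    (h : ∀ i, d i = 1 → ((X : Matrix κ κ ℂ) *ᵥ σ) i = 0) :
    (grover σ hσ d hd X : Matrix κ κ ℂ) *ᵥ σ = σ := by
  have h1 : (signGate d hd : Matrix κ κ ℂ) *ᵥ ((X : Matrix κ κ ℂ) *ᵥ σ) =
      - ((X : Matrix κ κ ℂ) *ᵥ σ) := by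
    ext i
    rw [signGate_mulVec]
    rcases mul_self_eq_one_iff.1 (hd i) with hi | hi
    · simp [h i hi]
    · simp [hi]
  have hXX' : (X : Matrix κ κ ℂ) * X = 1 := congrArg Subtype.val hXX
  rw [grover_mulVec, h1, Matrix.mulVec_neg, Matrix.mulVec_mulVec, hXX', Matrix.one_mulVec,
    vecReflection_mulVec, dotProduct_neg, star_dotProduct_self, hσ]
  simp only [Complex.ofReal_one]
  module

/-- The weight of the vector `v` on the coordinates where the sign is `1`. -/
noncomputable def posWeight (d : κ → ℝ) (v : κ → ℂ) : ℝ := ∑ i with d i = 1, ‖v i‖ ^ 2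

lemma exists_grover_mulVec_sub_eq (hXX : X * X = 1)
    (hs : 0 < posWeight d ((X : Matrix κ κ ℂ) *ᵥ σ)) :
    ∃ u, (grover σ hσ d hd X : Matrix κ κ ℂ) *ᵥ u - u = σ ∧
      4 * normSqVec u = 1 / posWeight d ((X : Matrix κ κ ℂ) *ᵥ σ) := by
  set s := posWeight d ((X : Matrix κ κ ℂ) *ᵥ σ) with hsdef
  have hXX' : (X : Matrix κ κ ℂ) * X = 1 := congrArg Subtype.val hXX
  have hXstar : (X : Matrix κ κ ℂ)ᴴ = X := by
    have : star X = X := by rw [Unitary.star_eq_inv, inv_eq_of_mul_eq_one_left hXX]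
    exact congrArg Subtype.val this
  -- The part of `X σ` on the positive coordinates. `X D X` fixes `X w`, and `⟨σ, X w⟩ = s`, so `G`
  -- moves `X w` by `-2 s σ`; rescaling gives `u`.
  let w : κ → ℂ := fun i => if d i = 1 then ((X : Matrix κ κ ℂ) *ᵥ σ) i else 0
  have hw : normSqVec w = s := by
    simp only [normSqVec, w, hsdef, posWeight, Finset.sum_filter]
    refine Finset.sum_congr rfl fun i _ => ?_
    split_ifs <;> simp
  have hdw : (signGate d hd : Matrix κ κ ℂ) *ᵥ w = w := by
    ext i
    rw [signGate_mulVec]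
    by_cases h : d i = 1 <;> simp [w, h]
  have hinner : star σ ⬝ᵥ ((X : Matrix κ κ ℂ) *ᵥ w) = s := by
    rw [Matrix.dotProduct_mulVec, ← hXstar, ← Matrix.star_mulVec, ← hw, ← star_dotProduct_self]
    refine Finset.sum_congr rfl fun i _ => ?_
    by_cases h : d i = 1 <;> simp [w, h]
  have hrot : (grover σ hσ d hd X : Matrix κ κ ℂ) *ᵥ ((X : Matrix κ κ ℂ) *ᵥ w) =
      (X : Matrix κ κ ℂ) *ᵥ w - (2 * (s : ℂ)) • σ := by
    rw [grover_mulVec, Matrix.mulVec_mulVec w, hXX', Matrix.one_mulVec, hdw,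
      vecReflection_mulVec, hinner]
  have hs0 : (s : ℂ) ≠ 0 := by exact_mod_cast hs.ne'
  refine ⟨(-(1 / (2 * (s : ℂ)))) • ((X : Matrix κ κ ℂ) *ᵥ w), ?_, ?_⟩
  · rw [Matrix.mulVec_smul, hrot, smul_sub, sub_sub_cancel_left, smul_smul, ← neg_smul]
    rw [show -(-(1 / (2 * (s : ℂ))) * (2 * (s : ℂ))) = 1 by field_simp, one_smul]
  · rw [normSqVec_smul, normSqVec_unitary_mulVec, hw, norm_neg, norm_div, norm_mul,
      Complex.norm_real, Real.norm_of_nonneg hs.le]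
    simp only [norm_one, Complex.norm_ofNat]
    field_simp
    norm_num

end Rotation

/-! ### Circuits that act separately in the sectors of a counter register -/

section Sectors

variable {ι F : Type} {J : ℕ}

/-- The state of the memory with control qubit `false` and with component `Φ j` in the sector where
the counter has the value `j`. -/
noncomputable def sectorState (Φ : Fin J → ι × F → ℂ) : Bool × (ι × (F × Fin J)) → ℂ :=
  fun m => if m.1 then 0 else Φ m.2.2.2 (m.2.1, m.2.2.1)

/-- Separate the part of the memory on which the gates act from the control qubit and the
counter. -/
def sectorEquiv (ι F : Type) (J : ℕ) : Bool × (ι × (F × Fin J)) ≃ (ι × F) × (Bool × Fin J) where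
  toFun m := ((m.2.1, m.2.2.1), (m.1, m.2.2.2))
  invFun m := (m.2.1, (m.1.1, (m.1.2, m.2.2)))
  left_inv _ := rfl
  right_inv _ := rfl

variable [Fintype ι] [Fintype F]

lemma sum_sector {R : Type} [AddCommMonoid R] (f : Bool × (ι × (F × Fin J)) → R)
    (hf : ∀ m, f (true, m) = 0) : ∑ m, f m = ∑ j, ∑ i : ι × F, f (false, (i.1, (i.2, j))) := by
  rw [Fintype.sum_prod_type, Fintype.sum_bool]
  simp only [hf, Finset.sum_const_zero, zero_add, Fintype.sum_prod_type]
  rw [Finset.sum_comm (s := (Finset.univ : Finset (Fin J)))]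
  refine Finset.sum_congr rfl fun i _ => ?_
  rw [Finset.sum_comm]

lemma normSqVec_sectorState (Φ : Fin J → ι × F → ℂ) :
    normSqVec (sectorState Φ) = ∑ j, normSqVec (Φ j) := by
  rw [normSqVec, sum_sector _ (by simp [sectorState])]
  rfl

lemma star_sectorState_dotProduct (Φ Ψ : Fin J → ι × F → ℂ) :
    star (sectorState Φ) ⬝ᵥ sectorState Ψ = ∑ j, star (Φ j) ⬝ᵥ Ψ j := by
  rw [dotProduct, sum_sector _ (by simp [sectorState])]
  rfl

variable [DecidableEq ι] [DecidableEq F]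

/-- The gate that acts by `V j` in sector `j`. -/
noncomputable def sectorGate (V : Fin J → Matrix.unitaryGroup (ι × F) ℂ) :
    Matrix.unitaryGroup (Bool × (ι × (F × Fin J))) ℂ :=
  ⟨(Matrix.blockDiagonal fun o : Bool × Fin J => (V o.2 : Matrix (ι × F) (ι × F) ℂ)).submatrix
      (sectorEquiv ι F J) (sectorEquiv ι F J), by
    rw [Matrix.mem_unitaryGroup_iff, Matrix.star_eq_conjTranspose, Matrix.conjTranspose_submatrix,
      Matrix.submatrix_mul_equiv, Matrix.blockDiagonal_conjTranspose, ← Matrix.blockDiagonal_mul]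
    have : ∀ o : Bool × Fin J, (V o.2 : Matrix (ι × F) (ι × F) ℂ) * (V o.2 : Matrix _ _ ℂ)ᴴ = 1 :=
      fun o => by
        rw [← Matrix.star_eq_conjTranspose]
        exact Unitary.coe_mul_star_self _
    simp only [this]
    rw [show (fun _ : Bool × Fin J => (1 : Matrix (ι × F) (ι × F) ℂ)) = 1 from rfl,
      Matrix.blockDiagonal_one, Matrix.submatrix_one_equiv]⟩

lemma sectorGate_mulVec (V : Fin J → Matrix.unitaryGroup (ι × F) ℂ) (Φ : Fin J → ι × F → ℂ) :
    (sectorGate V).1 *ᵥ sectorState Φ =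
      sectorState fun j => (V j : Matrix (ι × F) (ι × F) ℂ) *ᵥ Φ j := by
  ext ⟨b, i, f, j⟩
  rw [Matrix.mulVec, dotProduct, sum_sector _ (by simp [sectorState])]
  cases b <;>
    simp [sectorState, sectorGate, sectorEquiv, Matrix.blockDiagonal_apply, Matrix.mulVec,
      dotProduct]

/-- The action of the oracle on the query register and a work register `F`. -/
noncomputable def extendOracle (F : Type) [Fintype F] [DecidableEq F]
    (U : Matrix.unitaryGroup ι ℂ) : Matrix.unitaryGroup (ι × F) ℂ :=
  ⟨(U : Matrix ι ι ℂ) ⊗ₖ (1 : Matrix F F ℂ),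
    Matrix.kronecker_mem_unitary U.2 (Submonoid.one_mem _)⟩

lemma extendOracle_mulVec (U : Matrix.unitaryGroup ι ℂ) (v : ι × F → ℂ) (i : ι) (f : F) :
    ((extendOracle F U : Matrix _ _ ℂ) *ᵥ v) (i, f) =
      ∑ i', (U : Matrix ι ι ℂ) i i' * v (i', f) := by
  rw [Matrix.mulVec, dotProduct, Fintype.sum_prod_type]
  refine Finset.sum_congr rfl fun i' _ => ?_
  rw [Finset.sum_eq_single f]
  · simp [extendOracle]
  · intro f' _ hne
    simp [extendOracle, hne.symm]
  · simp

lemma query_mulVec (U : Matrix.unitaryGroup ι ℂ) (inverse : Bool) (Φ : Fin J → ι × F → ℂ) :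
    (QueryStep.query (W := F × Fin J) false inverse).toMatrix U *ᵥ sectorState Φ =
      sectorState fun j =>
        (extendOracle F (if inverse then star U else U) : Matrix _ _ ℂ) *ᵥ Φ j := by
  have hQ : (if inverse then (U : Matrix ι ι ℂ)ᴴ else U) =
      ((if inverse then star U else U : Matrix.unitaryGroup ι ℂ) : Matrix ι ι ℂ) := by
    cases inverse <;> rfl
  ext ⟨b, i, f, j⟩
  simp only [QueryStep.toMatrix, Bool.false_eq_true, if_false, hQ]
  generalize (if inverse then star U else U) = V
  rw [Matrix.mulVec, dotProduct, sum_sector _ (by simp [sectorState])]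
  cases b
  · rw [sectorState, if_neg (by simp), extendOracle_mulVec, Finset.sum_eq_single j]
    · rw [Fintype.sum_prod_type]
      refine Finset.sum_congr rfl fun i' _ => ?_
      rw [Finset.sum_eq_single f]
      · simp [sectorState]
      · intro f' _ hne
        simp [hne.symm]
      · simp
    · intro j' _ hne
      simp [hne.symm]
    · simp
  · simp [sectorState]

/-- The oracle conjugate `U† D U` of a sign gate `D`. -/
noncomputable def oracleConj (d : ι × F → ℝ) (hd : ∀ i, d i * d i = 1)
    (U : Matrix.unitaryGroup ι ℂ) : Matrix.unitaryGroup (ι × F) ℂ :=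
  star (extendOracle F U) * signGate d hd * extendOracle F U

lemma extendOracle_star (U : Matrix.unitaryGroup ι ℂ) :
    extendOracle F (star U) = star (extendOracle F U) := by
  apply Subtype.ext
  change (star U : Matrix ι ι ℂ) ⊗ₖ (1 : Matrix F F ℂ) = ((U : Matrix ι ι ℂ) ⊗ₖ 1)ᴴ
  rw [Matrix.conjTranspose_kronecker, Matrix.conjTranspose_one, Matrix.star_eq_conjTranspose]

lemma signGate_mul_self {κ : Type} [Fintype κ] [DecidableEq κ] (d : κ → ℝ)
    (hd : ∀ i, d i * d i = 1) : signGate d hd * signGate d hd = 1 := by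
  apply Subtype.ext
  simp only [signGate, Submonoid.coe_mul, Matrix.diagonal_mul_diagonal, Submonoid.coe_one]
  rw [← Matrix.diagonal_one]
  congr 1
  ext i
  exact_mod_cast hd i

lemma oracleConj_mul_self (d : ι × F → ℝ) (hd : ∀ i, d i * d i = 1)
    (U : Matrix.unitaryGroup ι ℂ) : oracleConj d hd U * oracleConj d hd U = 1 := by
  rw [oracleConj, Unitary.star_eq_inv]
  calc _ = (extendOracle F U)⁻¹ * (signGate d hd * signGate d hd) * extendOracle F U := by group
    _ = 1 := by rw [signGate_mul_self]; group

/-- Run the steps `l` on the state `ψ` with oracle `U`. -/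
noncomputable def runSteps {W : Type} [Fintype W] [DecidableEq W] (U : Matrix.unitaryGroup ι ℂ)
    (l : List (QueryStep ι W)) (ψ : Bool × (ι × W) → ℂ) : Bool × (ι × W) → ℂ :=
  l.foldl (fun ψ s => s.toMatrix U *ᵥ ψ) ψ

/-- The steps that apply `U† D U`. -/
noncomputable def oracleConjSteps (d : ι × F → ℝ) (hd : ∀ i, d i * d i = 1) (J : ℕ) :
    List (QueryStep ι (F × Fin J)) :=
  [.query false false, .gate (sectorGate fun _ => signGate d hd), .query false true]

lemma runSteps_oracleConjSteps (d : ι × F → ℝ) (hd : ∀ i, d i * d i = 1)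
    (U : Matrix.unitaryGroup ι ℂ) (Φ : Fin J → ι × F → ℂ) :
    runSteps U (oracleConjSteps d hd J) (sectorState Φ) =
      sectorState fun j => (oracleConj d hd U : Matrix _ _ ℂ) *ᵥ Φ j := by
  simp only [runSteps, oracleConjSteps, List.foldl_cons, List.foldl_nil, query_mulVec]
  rw [QueryStep.toMatrix, sectorGate_mulVec, query_mulVec]
  simp only [oracleConj, if_true, Bool.false_eq_true, if_false, extendOracle_star,
    Matrix.mulVec_mulVec, Submonoid.coe_mul, Matrix.mul_assoc]

variable {σ : ι × F → ℂ} (hσ : normSqVec σ = 1) {d e : ι × F → ℝ} (hd : ∀ i, d i * d i = 1)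
  (he : ∀ i, e i * e i = 1)

/-- The steps that apply `grover` in the sectors above `t` and nothing in the others. -/
noncomputable def groverSteps (hσ : normSqVec σ = 1) (hd : ∀ i, d i * d i = 1)
    (he : ∀ i, e i * e i = 1) (J t : ℕ) : List (QueryStep ι (F × Fin J)) :=
  oracleConjSteps e he J ++ .gate (sectorGate fun j => if t < j then signGate d hd else 1) ::
    (oracleConjSteps e he J ++
      [.gate (sectorGate fun j => if t < j then vecReflection σ hσ else 1)])

/-- The queries run uncontrolled in every sector. Where the two gates are switched off, the two
copies of `U† D U` cancel because each is an involution. -/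
lemma runSteps_groverSteps (U : Matrix.unitaryGroup ι ℂ) (t : ℕ) (Φ : Fin J → ι × F → ℂ) :
    runSteps U (groverSteps hσ hd he J t) (sectorState Φ) = sectorState fun j =>
      if t < j then (grover σ hσ d hd (oracleConj e he U) : Matrix _ _ ℂ) *ᵥ Φ j else Φ j := by
  have hXX : (oracleConj e he U : Matrix (ι × F) (ι × F) ℂ) * oracleConj e he U = 1 :=
    congrArg Subtype.val (oracleConj_mul_self e he U)
  have h := fun Φ => runSteps_oracleConjSteps (J := J) e he U Φ
  simp only [runSteps] at h ⊢
  rw [groverSteps, List.foldl_append, h, List.foldl_cons, QueryStep.toMatrix, sectorGate_mulVec,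
    List.foldl_append, h, List.foldl_cons, List.foldl_nil, QueryStep.toMatrix, sectorGate_mulVec]
  congr 1
  ext1 j
  by_cases ht : t < j
  · simp only [ht, if_true, grover_mulVec]
  · simp only [ht, if_false, Submonoid.coe_one, Matrix.one_mulVec]
    rw [Matrix.mulVec_mulVec, hXX, Matrix.one_mulVec]

lemma runSteps_flatMap_groverSteps (U : Matrix.unitaryGroup ι ℂ) (φ : ι × F → ℂ) (t : ℕ) :
    runSteps U ((List.range t).flatMap (groverSteps hσ hd he J)) (sectorState fun _ => φ) =
      sectorState fun j =>
        (grover σ hσ d hd (oracleConj e he U) : Matrix _ _ ℂ) ^ min t j *ᵥ φ := by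
  induction t with
  | zero => simp [runSteps]
  | succ t ih =>
    rw [List.range_succ, List.flatMap_append, runSteps, List.foldl_append]
    change runSteps U _ (runSteps U _ _) = _
    rw [ih, List.flatMap_singleton, runSteps_groverSteps]
    congr 1
    ext1 j
    split_ifs with h
    · rw [Matrix.mulVec_mulVec, ← pow_succ', min_eq_left h.le, min_eq_left h]
    · rw [min_eq_right (not_lt.1 h), min_eq_right ((not_lt.1 h).trans t.le_succ)]

lemma sum_cost_flatMap_groverSteps (t : ℕ) :
    (((List.range t).flatMap (groverSteps hσ hd he J)).map QueryStep.cost).sum = 4 * t := by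
  induction t with
  | zero => simp
  | succ t ih =>
    rw [List.range_succ, List.flatMap_append, List.map_append, List.sum_append, ih]
    simp [groverSteps, oracleConjSteps, QueryStep.cost]
    ring

end Sectors

/-! ### Detection of nonzero amplitudes -/

section Detector

variable {ι F : Type} [DecidableEq ι]

/-- The basis state `i₀` in superposition over the work register. -/
noncomputable def startVec (F : Type) [Fintype F] (i₀ : ι) : ι × F → ℂ :=
  fun i => if i.1 = i₀ then ((1 / Real.sqrt (Fintype.card F) : ℝ) : ℂ) else 0

/-- The signs that single out the basis state `i₀`. -/
def startSign (F : Type) (i₀ : ι) : ι × F → ℝ := fun i => if i.1 = i₀ then 1 else -1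

lemma startSign_mul_self (i₀ : ι) (i : ι × F) : startSign F i₀ i * startSign F i₀ i = 1 := by
  rw [startSign]
  split_ifs <;> norm_num

variable [Fintype ι] [Fintype F]

lemma normSqVec_startVec [Nonempty F] (i₀ : ι) : normSqVec (startVec F i₀) = 1 := by
  have hF : (0 : ℝ) < Fintype.card F := by exact_mod_cast Fintype.card_pos
  rw [normSqVec, Fintype.sum_prod_type, Finset.sum_eq_single i₀]
  · simp only [startVec, if_true, Complex.norm_real, Real.norm_eq_abs, sq_abs, div_pow, one_pow,
      Real.sq_sqrt hF.le, Finset.sum_const, Finset.card_univ, nsmul_eq_mul]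
    field_simp
  · intro i _ hi
    simp [startVec, hi]
  · simp

lemma posWeight_startSign (i₀ : ι) (v : ι × F → ℂ) :
    posWeight (startSign F i₀) v = ∑ f, ‖v (i₀, f)‖ ^ 2 := by
  have h : ∀ i : ι × F, startSign F i₀ i = 1 ↔ i.1 = i₀ := fun i => by
    rw [startSign]
    split_ifs with hi <;> simp [hi]
    norm_num
  rw [posWeight, Finset.sum_filter, Fintype.sum_prod_type, Finset.sum_eq_single i₀]
  · simp [h]
  · intro i _ hi
    simp [h, hi]
  · simp

/-- The amplitude with which `U† D U` preserves the basis state `i₀`, for the sign gate `D` of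
`χ`. -/
noncomputable def returnAmplitude (U : Matrix.unitaryGroup ι ℂ) (i₀ : ι) (χ : ι → ℝ) : ℝ :=
  ∑ i, χ i * ‖(U : Matrix ι ι ℂ) i i₀‖ ^ 2

variable [DecidableEq F]

/-- The oracle leaves the work register alone and `D` is diagonal, so each `f` evolves separately.
-/
lemma oracleConj_mulVec_startVec (U : Matrix.unitaryGroup ι ℂ) (i₀ : ι) (e : ι × F → ℝ)
    (he : ∀ i, e i * e i = 1) (f : F) :
    ((oracleConj e he U : Matrix _ _ ℂ) *ᵥ startVec F i₀) (i₀, f) =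
      ((1 / Real.sqrt (Fintype.card F) * returnAmplitude U i₀ fun i => e (i, f) : ℝ) : ℂ) := by
  have h1 : ∀ i, ((extendOracle F U : Matrix _ _ ℂ) *ᵥ startVec F i₀) (i, f) =
      (U : Matrix ι ι ℂ) i i₀ * ((1 / Real.sqrt (Fintype.card F) : ℝ) : ℂ) := fun i => by
    rw [extendOracle_mulVec, Finset.sum_eq_single i₀]
    · simp [startVec]
    · intro i' _ hi'
      simp [startVec, hi']
    · simp
  have h2 : ∀ z : ℂ, ((‖z‖ ^ 2 : ℝ) : ℂ) = star z * z := fun z => by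
    rw [Complex.ofReal_pow, ← Complex.conj_mul']
    rfl
  simp only [oracleConj, Submonoid.coe_mul]
  rw [← Matrix.mulVec_mulVec, ← Matrix.mulVec_mulVec, ← extendOracle_star, extendOracle_mulVec,
    returnAmplitude, Finset.mul_sum, Complex.ofReal_sum]
  refine Finset.sum_congr rfl fun i _ => ?_
  rw [signGate_mulVec, h1, Complex.ofReal_mul, Complex.ofReal_mul, h2]
  change star ((U : Matrix ι ι ℂ) i i₀) * _ = _
  ring

/-- The mean square of the return amplitudes for a family of sign functions. -/
noncomputable def meanSqAmplitude (U : Matrix.unitaryGroup ι ℂ) (i₀ : ι) (χ : F → ι → ℝ) : ℝ :=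
  (∑ f, returnAmplitude U i₀ (χ f) ^ 2) / Fintype.card F

lemma posWeight_oracleConj (U : Matrix.unitaryGroup ι ℂ) (i₀ : ι) (χ : F → ι → ℝ)
    (he : ∀ i : ι × F, χ i.2 i.1 * χ i.2 i.1 = 1) :
    posWeight (startSign F i₀) ((oracleConj (fun i => χ i.2 i.1) he U : Matrix _ _ ℂ) *ᵥ
      startVec F i₀) = meanSqAmplitude U i₀ χ := by
  rw [posWeight_startSign, meanSqAmplitude, Finset.sum_div]
  refine Finset.sum_congr rfl fun f _ => ?_
  rw [oracleConj_mulVec_startVec, Complex.norm_real, Real.norm_eq_abs, sq_abs, mul_pow, div_pow,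
    one_pow, Real.sq_sqrt (Nat.cast_nonneg _)]
  ring

/-- A query algorithm that runs, in superposition over `j < J`, `j` Grover steps and accepts if the
memory returns to its initial state. -/
theorem exists_detector [Nonempty F] (i₀ : ι) (χ : F → ι → ℝ) (hχ : ∀ f i, χ f i * χ f i = 1)
    {J : ℕ} (hJ : 0 < J) :
    ∃ T : QueryAlgorithm ι, T.queryCount = 4 * J ∧ ∀ U : Matrix.unitaryGroup ι ℂ,
      ((∀ f, returnAmplitude U i₀ (χ f) = 0) → T.yesProb U = 1) ∧
      (0 < meanSqAmplitude U i₀ χ →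
        1 - 1 / (J ^ 2 * meanSqAmplitude U i₀ χ) ≤ T.noProb U) := by
  have he : ∀ i : ι × F, χ i.2 i.1 * χ i.2 i.1 = 1 := fun i => hχ i.2 i.1
  have hσ := normSqVec_startVec (F := F) i₀
  have hd := startSign_mul_self (F := F) i₀
  set σ := startVec F i₀
  have hJ0 : (0 : ℝ) < J := by exact_mod_cast hJ
  let c : ℂ := ((1 / Real.sqrt J : ℝ) : ℂ)
  have hc : ‖c‖ ^ 2 = 1 / J := by
    simp only [c, Complex.norm_real, Real.norm_eq_abs, sq_abs, div_pow, one_pow,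
      Real.sq_sqrt hJ0.le]
  have hν : normSqVec (sectorState fun _ : Fin J => c • σ) = 1 := by
    rw [normSqVec_sectorState]
    simp only [normSqVec_smul, hc, hσ, mul_one, Finset.sum_const, Finset.card_univ,
      Fintype.card_fin, nsmul_eq_mul]
    field_simp
  obtain ⟨f₀⟩ := ‹Nonempty F›
  let m₀ : Bool × (ι × (F × Fin J)) := (false, (i₀, (f₀, ⟨0, hJ⟩)))
  -- `V` prepares `σ` in superposition over the counter. Undoing it at the end makes the amplitude
  -- at `m₀` the average of `⟨σ, G ^ j σ⟩`.
  obtain ⟨V, hV⟩ := exists_unitary_mulVec_single m₀ _ hν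
  let T : QueryAlgorithm ι :=
    { W := F × Fin J
      init := m₀
      steps := .gate V :: ((List.range J).flatMap (groverSteps hσ hd he J) ++ [.gate (star V)])
      accept := {m₀} }
  refine ⟨T, ?_, fun U => ?_⟩
  · simp only [QueryAlgorithm.queryCount, T, List.map_cons, List.sum_cons, List.map_append,
      List.sum_append, sum_cost_flatMap_groverSteps]
    simp [QueryStep.cost]
  set G := grover σ hσ (startSign F i₀) hd (oracleConj (fun i => χ i.2 i.1) he U) with hG
  have hfinal : T.finalState U = (star V : Matrix.unitaryGroup _ ℂ).1 *ᵥ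
      sectorState fun j : Fin J => G.1 ^ (j : ℕ) *ᵥ (c • σ) := by
    have h := runSteps_flatMap_groverSteps (J := J) hσ hd he U (c • σ) J
    simp only [runSteps] at h
    simp only [QueryAlgorithm.finalState, T, List.foldl_cons, List.foldl_append, List.foldl_nil]
    rw [show QueryStep.toMatrix U (.gate V) = V.1 from rfl, hV, h, QueryStep.toMatrix]
    simp only [min_eq_right (Fin.is_lt _).le, hG]
  have hpow : ∀ j : ℕ, normSqVec (G.1 ^ j *ᵥ (c • σ)) = 1 / J := fun j => by
    rw [show G.1 ^ j =
      ((G ^ j : Matrix.unitaryGroup _ ℂ) : Matrix _ _ ℂ) from rfl, normSqVec_unitary_mulVec,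
      normSqVec_smul, hσ, hc, mul_one]
  have hnorm : normSqVec (T.finalState U) = 1 := by
    rw [hfinal, normSqVec_unitary_mulVec, normSqVec_sectorState]
    simp only [hpow, Finset.sum_const, Finset.card_univ, Fintype.card_fin, nsmul_eq_mul]
    field_simp
  have hinit : T.finalState U m₀ = (‖c‖ ^ 2 : ℝ) *
      ∑ j ∈ Finset.range J, star σ ⬝ᵥ (G.1 ^ j *ᵥ σ) := by
    have h1 : T.finalState U m₀ = star (sectorState fun _ : Fin J => c • σ) ⬝ᵥ
        sectorState fun j : Fin J => G.1 ^ (j : ℕ) *ᵥ (c • σ) := by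
      rw [hfinal, ← hV, Matrix.mulVec_single_one]
      rfl
    rw [h1, star_sectorState_dotProduct, Finset.mul_sum, ← Fin.sum_univ_eq_sum_range (fun j =>
      ((‖c‖ ^ 2 : ℝ) : ℂ) * (star σ ⬝ᵥ (G.1 ^ j *ᵥ σ))) J]
    refine Finset.sum_congr rfl fun j _ => ?_
    rw [Matrix.mulVec_smul, star_smul, smul_dotProduct, dotProduct_smul, smul_smul, smul_eq_mul,
      Complex.ofReal_pow, ← Complex.conj_mul']
    rfl
  have hyes : T.yesProb U =
      (1 / J) ^ 2 * ‖∑ j ∈ Finset.range J, star σ ⬝ᵥ (G.1 ^ j *ᵥ σ)‖ ^ 2 := by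
    change ∑ x ∈ ({m₀} : Finset _), ‖T.finalState U x‖ ^ 2 = _
    rw [Finset.sum_singleton, hinit, hc, norm_mul, mul_pow, Complex.norm_real, Real.norm_eq_abs,
      sq_abs]
  have hno : T.noProb U = 1 - T.yesProb U := by
    rw [← hnorm, normSqVec, QueryAlgorithm.noProb, QueryAlgorithm.yesProb,
      ← Finset.sum_add_sum_compl T.accept]
    ring
  have hXX := oracleConj_mul_self (fun i : ι × F => χ i.2 i.1) he U
  constructor
  · intro h0
    have hGσ : G.1 *ᵥ σ = σ := by
      refine grover_mulVec_self hσ hd hXX fun i hi => ?_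
      obtain ⟨i, f⟩ := i
      have : i = i₀ := by
        by_contra hne
        rw [startSign, if_neg hne] at hi
        norm_num at hi
      subst this
      rw [oracleConj_mulVec_startVec, h0 f]
      simp
    have hGj : ∀ j : ℕ, G.1 ^ j *ᵥ σ = σ := fun j => by
      induction j with
      | zero => rw [pow_zero, Matrix.one_mulVec]
      | succ j ih => rw [pow_succ, ← Matrix.mulVec_mulVec, hGσ, ih]
    rw [hyes]
    simp only [hGj, star_dotProduct_self, hσ, Complex.ofReal_one, Finset.sum_const,
      Finset.card_range, nsmul_eq_mul, mul_one, Complex.norm_natCast]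
    field_simp
  · intro hpos
    rw [← posWeight_oracleConj U i₀ χ he] at hpos ⊢
    obtain ⟨u, hu, hnu⟩ := exists_grover_mulVec_sub_eq hσ hd hXX hpos
    have hle := norm_sum_star_dotProduct_pow_mulVec_sq_le G hσ hu J
    rw [hnu] at hle
    have : (1 / (J : ℝ)) ^ 2 * ‖∑ j ∈ Finset.range J,
        star σ ⬝ᵥ (G.1 ^ j *ᵥ σ)‖ ^ 2 ≤ (1 / (J : ℝ)) ^ 2 * (1 / posWeight
          (startSign F i₀) ((oracleConj (fun i => χ i.2 i.1) he U : Matrix _ _ ℂ) *ᵥ σ)) := by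
      gcongr
    rw [hno, hyes]
    refine sub_le_sub_left (this.trans (le_of_eq ?_)) 1
    simp only [one_div, mul_inv, inv_pow]
    rfl

end Detector

/-! ### The tester -/

section Tester

variable {A : Type} [Fintype A] [DecidableEq A]

/-- The signs depend only on the second register, so the purification enters only through `‖φ x‖ =
1`. -/
lemma returnAmplitude_of_isPurifiedOracle {n : ℕ} {a₀ : A} {p : (Fin n → Bool) → ℝ}
    (hp : p ∈ stdSimplex ℝ (Fin n → Bool)) {U : Matrix.unitaryGroup (A × (Fin n → Bool)) ℂ}
    (hU : IsPurifiedOracle a₀ (fun _ => false) p U) (S : Finset (Fin n)) :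
    returnAmplitude U (a₀, fun _ => false) (fun i => walsh S i.2) = bias p S := by
  obtain ⟨φ, hφ, h⟩ := hU
  rw [Matrix.mulVec_single_one] at h
  have hcol : ∀ (a : A) (x : Fin n → Bool), U.1 (a, x) (a₀, fun _ => false) =
      (Real.sqrt (p x) : ℂ) * φ x a := fun a x => congrFun h (a, x)
  have hnorm : ∀ x, ∑ a, ‖φ x a‖ ^ 2 = 1 := fun x => by
    rw [← EuclideanSpace.norm_sq_eq, hφ.1 x, one_pow]
  rw [returnAmplitude, Fintype.sum_prod_type, Finset.sum_comm, bias]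
  refine Finset.sum_congr rfl fun x _ => ?_
  simp only [hcol, norm_mul, mul_pow, Complex.norm_real, Real.norm_eq_abs, sq_abs,
    Real.sq_sqrt (hp.1 x)]
  rw [← Finset.mul_sum, ← Finset.mul_sum, hnorm, mul_one, mul_comm]

/-- Functions `Fin k → Fin n` enumerate the small sets, with repetitions, by a register of exactly
`n ^ k` values. Repetitions do no harm, since only a lower bound on the sum of squared biases is
needed. -/
lemma exists_image_eq {n k : ℕ} {S : Finset (Fin n)} (hS : S ∈ smallSets (Fin n) k) :
    ∃ f : Fin k → Fin n, Finset.univ.image f = S := by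
  obtain ⟨hne, hcard⟩ := mem_smallSets.1 hS
  have : Nonempty S := (Finset.nonempty_iff_ne_empty.2 hne).to_subtype
  have hle : Fintype.card S ≤ Fintype.card (Fin k) := by simpa using hcard
  obtain ⟨g⟩ := Function.Embedding.nonempty_of_card_le hle
  -- Off the range of `g`, the default value of `invFun` still lies in `S`.
  refine ⟨fun i => (Function.invFun g i : S), ?_⟩
  ext a
  simp only [Finset.mem_image, Finset.mem_univ, true_and]
  constructor
  · rintro ⟨i, rfl⟩
    exact Subtype.property _
  · intro ha
    exact ⟨g ⟨a, ha⟩, by rw [Function.leftInverse_invFun g.injective]⟩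

lemma image_mem_smallSets {n k : ℕ} (hk : 1 ≤ k) (f : Fin k → Fin n) :
    Finset.univ.image f ∈ smallSets (Fin n) k := by
  refine mem_smallSets.2 ⟨?_, ?_⟩
  · have : Nonempty (Fin k) := ⟨⟨0, hk⟩⟩
    exact Finset.nonempty_iff_ne_empty.1 (Finset.univ_nonempty.image f)
  · simpa using Finset.card_image_le (s := (Finset.univ : Finset (Fin k))) (f := f)

lemma sum_smallSets_le_sum_image {n k : ℕ} (c : Finset (Fin n) → ℝ) (hc : ∀ S, 0 ≤ c S) :
    ∑ S ∈ smallSets (Fin n) k, c S ≤ ∑ f : Fin k → Fin n, c (Finset.univ.image f) := by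
  have h : smallSets (Fin n) k ⊆
      (Finset.univ : Finset (Fin k → Fin n)).image fun f => Finset.univ.image f := fun S hS => by
    obtain ⟨f, hf⟩ := exists_image_eq hS
    exact Finset.mem_image.2 ⟨f, Finset.mem_univ f, hf⟩
  refine (Finset.sum_le_sum_of_subset_of_nonneg h fun S _ _ => hc S).trans ?_
  exact Finset.sum_image_le_of_nonneg fun S _ => hc S

/-- The algorithm that accepts without a query. -/
def alwaysAccept {ι : Type} [Fintype ι] [DecidableEq ι] (i₀ : ι) : QueryAlgorithm ι where
  W := Unit
  init := (false, (i₀, ()))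
  steps := []
  accept := {(false, (i₀, ()))}

lemma yesProb_alwaysAccept {ι : Type} [Fintype ι] [DecidableEq ι] (i₀ : ι)
    (U : Matrix.unitaryGroup ι ℂ) : (alwaysAccept i₀).yesProb U = 1 := by
  change ∑ x ∈ ({(false, (i₀, ()))} : Finset (Bool × (ι × Unit))),
    ‖(Pi.single (false, (i₀, ())) 1 : Bool × (ι × Unit) → ℂ) x‖ ^ 2 = 1
  simp

lemma not_isFar_of_lt {n k : ℕ} (hnk : n < k) {ε : ℝ} (hε : 0 < ε) {p : (Fin n → Bool) → ℝ}
    (hp : p ∈ stdSimplex ℝ (Fin n → Bool)) : ¬ IsFarFromKWiseUniform k ε p := by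
  intro h
  have := h p hp fun S hS => absurd (Finset.card_le_univ S) (by simp [hS, hnk])
  simp [tvDist] at this
  linarith

lemma not_isFar_of_one_lt {n k : ℕ} {ε : ℝ} (hε : 1 < ε) {p : (Fin n → Bool) → ℝ}
    (hp : p ∈ stdSimplex ℝ (Fin n → Bool)) : ¬ IsFarFromKWiseUniform k ε p := by
  intro h
  let q : (Fin n → Bool) → ℝ := fun _ => 1 / 2 ^ n
  have hq : q ∈ stdSimplex ℝ (Fin n → Bool) := by
    refine ⟨fun _ => by positivity, ?_⟩
    simp [q]
  have hb : ∀ S ∈ smallSets (Fin n) k, bias q S = 0 := fun S hS => by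
    rw [bias, ← Finset.mul_sum, sum_walsh_of_ne_empty (mem_smallSets.1 hS).1, mul_zero]
  have := h q hq (isKWiseUniform_of_bias_eq_zero hq hb)
  have := tvDist_le_one hp hq
  linarith

lemma isTester_alwaysAccept {n k : ℕ} {ε : ℝ} (a₀ : A)
    (h : ∀ p ∈ stdSimplex ℝ (Fin n → Bool), ¬ IsFarFromKWiseUniform k ε p) :
    IsKWiseUniformityTester (n := n) a₀ k ε (alwaysAccept (a₀, fun _ => false)) := by
  intro p hp U _
  refine ⟨fun _ => ?_, fun hfar => absurd hfar (h p hp)⟩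
  rw [yesProb_alwaysAccept]
  norm_num

/-- The tester of the detector for the characters of degrees `1, …, k`. -/
lemma exists_isTester {n k : ℕ} (hk : 1 ≤ k) (hkn : k ≤ n) {ε : ℝ} (hε : 0 < ε) (hε1 : ε ≤ 1)
    (a₀ : A) {J : ℕ} (hJ : 24 * 3 ^ k * Real.sqrt ((n : ℝ) ^ k) / ε ≤ J) :
    ∃ T : QueryAlgorithm (A × (Fin n → Bool)),
      IsKWiseUniformityTester a₀ k ε T ∧ T.queryCount = 4 * J := by
  have : Nonempty (Fin n) := ⟨⟨0, hk.trans hkn⟩⟩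
  have hn : (0 : ℝ) < (n : ℝ) ^ k := pow_pos (by exact_mod_cast hk.trans hkn) k
  have hJ0 : (0 : ℝ) < J := lt_of_lt_of_le (by positivity) hJ
  obtain ⟨T, hT, hprob⟩ := exists_detector (F := Fin k → Fin n)
    ((a₀, fun _ => false) : A × (Fin n → Bool))
    (fun f i => walsh (Finset.univ.image f) i.2) (fun f i => walsh_sq _ _)
    (J := J) (by exact_mod_cast hJ0)
  refine ⟨T, fun p hp U hU => ?_, hT⟩
  have hamp := fun S => returnAmplitude_of_isPurifiedOracle hp hU S
  obtain ⟨hyes, hno⟩ := hprob U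
  simp only [meanSqAmplitude, hamp] at hyes hno
  constructor
  · intro hunif
    rw [hyes fun f => bias_eq_zero_of_isKWiseUniform hkn hunif (image_mem_smallSets hk f)]
    norm_num
  · intro hfar
    have hlt := lt_sqrt_sum_bias_of_isFar hε hε1 hp hfar
    have hsq := (Real.lt_sqrt (by positivity)).1 hlt
    have hsum := sum_smallSets_le_sum_image (k := k) (fun S => bias p S ^ 2) fun S => sq_nonneg _
    have hcard : ((Fintype.card (Fin k → Fin n) : ℕ) : ℝ) = (n : ℝ) ^ k := by simp
    rw [hcard] at hno
    set B := ∑ f : Fin k → Fin n, bias p (Finset.univ.image f) ^ 2 with hBdef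
    have hB : (ε / 2 / (6 * 3 ^ k)) ^ 2 < B := hsq.trans_le hsum
    have hB0 : 0 < B := lt_of_le_of_lt (sq_nonneg _) hB
    -- The constant `24` gives `24 ^ 2 / 12 ^ 2 = 4`, so the acceptance probability is at most `1 /
    -- 3`.
    have hbig : 3 ≤ (J : ℝ) ^ 2 * (B / (n : ℝ) ^ k) := by
      calc (3 : ℝ) ≤ (24 * 3 ^ k * Real.sqrt ((n : ℝ) ^ k) / ε) ^ 2 *
            ((ε / 2 / (6 * 3 ^ k)) ^ 2 / (n : ℝ) ^ k) := by
            rw [div_pow, mul_pow, Real.sq_sqrt hn.le]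
            field_simp
            norm_num
        _ ≤ (J : ℝ) ^ 2 * (B / (n : ℝ) ^ k) := by gcongr
    refine le_trans ?_ (hno (by positivity))
    have : 1 / ((J : ℝ) ^ 2 * (B / (n : ℝ) ^ k)) ≤ 1 / 3 :=
      one_div_le_one_div_of_le (by norm_num) hbig
    linarith

end Tester

theorem theorem3 (k : ℕ) (hk : 1 ≤ k) :
    ∃ C : ℝ, 0 < C ∧
      ∀ (n : ℕ) (ε : ℝ), 0 < ε →
        ∀ (A : Type) [Fintype A] [DecidableEq A] (a₀ : A),
          ∃ T : QueryAlgorithm (A × (Fin n → Bool)),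
            IsKWiseUniformityTester a₀ k ε T ∧
            (T.queryCount : ℝ) ≤ C * (Real.sqrt ((n : ℝ) ^ k) / ε) := by
  -- Four queries per Grover step; the `+ 1` pays for rounding `J` up, as `√(n ^ k) / ε ≥ 1` in the
  -- main case.
  refine ⟨4 * (24 * 3 ^ k + 1), by positivity, fun n ε hε A _ _ a₀ => ?_⟩
  -- Here no distribution is far, and the query bound may fall below one, so no query is made.
  by_cases htriv : n < k ∨ 1 < ε
  · refine ⟨alwaysAccept (a₀, fun _ => false), isTester_alwaysAccept a₀ fun p hp => ?_, ?_⟩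
    · rcases htriv with h | h
      · exact not_isFar_of_lt h hε hp
      · exact not_isFar_of_one_lt h hp
    · change ((0 : ℕ) : ℝ) ≤ _
      rw [Nat.cast_zero]
      positivity
  · push Not at htriv
    obtain ⟨hkn, hε1⟩ := htriv
    obtain ⟨T, hT, hcount⟩ := exists_isTester hk hkn hε hε1 a₀ (Nat.le_ceil _)
    refine ⟨T, hT, ?_⟩
    have hn : (1 : ℝ) ≤ Real.sqrt ((n : ℝ) ^ k) :=
      Real.one_le_sqrt.2 (one_le_pow₀ (by exact_mod_cast hk.trans hkn))
    have h1 : 1 ≤ Real.sqrt ((n : ℝ) ^ k) / ε := (one_le_div hε).2 (hε1.trans hn)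
    have hceil := (Nat.ceil_lt_add_one (a := 24 * 3 ^ k * Real.sqrt ((n : ℝ) ^ k) / ε)
      (by positivity)).le
    rw [hcount, Nat.cast_mul]
    rw [mul_div_assoc] at hceil ⊢
    push_cast
    linarith
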